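/- **Theorem (Itemset Isomorphism is GI-complete).** An *itemset* over a finite domain $D$ is a set of subsets of $D$ (its *items*). Consider the following two decision problems. * **Itemset Isomorphism (II).** Input: two itemsets $S$ and $T$ over finite domains $D_S$ and $D_T$, each given by the size of its domain (in unary) and by its zero-one matrix, whose rows are the (distinct) items and whose columns are the elements of the domain. Question: is there a bijection $J : D_S \to D_T$ with $J(S) = T$, where $J(S) = \{\, \{J(d) \mid d \in I\} \mid I \in S \,\}$? * **Graph Isomorphism (GI).** Input: two finite undirected simple graphs $G = (V_G, E_G)$ and $H = (V_H, E_H)$, given by their adjacency matrices. Question: is there a bijection $I : V_G \to V_H$ such that, for all $v, w \in V_G$, $\{v,w\} \in E_G$ if and only if $\{I(v), I(w)\} \in E_H$? For decision problems $A$ and $B$ write $A \le_P B$ if there is a polynomial-time many-one (Karp) reduction from $A$ to $B$: a map $f$ from the inputs of $A$ to the inputs of $B$, computable by a Turing machine in time polynomial in the length of the encoded input, such that $x$ is a yes-instance of $A$ if and only if $f(x)$ is a yes-instance of $B$. Then II is GI-complete, i.e. polynomial-time equivalent to GI, and it lies in NP: $$\mathrm{GI} \le_P \mathrm{II}, \qquad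 \mathrm{II} \le_P \mathrm{GI}, \qquad \mathrm{II} \in \mathrm{NP}.$$ -/

import Mathlib

namespace IsoComplexity

open Computability

/-! ### Decision problems, polynomial-time reductions, NP -/

/-- A decision problem: a set of inputs, an injective encoding of the inputs as strings over a
finite alphabet, and a yes/no question about the inputs. -/
structure DecisionProblem where
  /-- the inputs -/
  Input : Type
  /-- the alphabet -/
  Alphabet : Type
  finite_alphabet : Finite Alphabet
  /-- the encoding of the inputs as strings over the alphabet -/
  enc : Encoding Input Alphabet
  /-- the question -/
  Question : Input → Prop

/-- Polynomial-time many-one (Karp) reducibility: some function computed by a Turing machine in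
time polynomial in the length of the encoded input maps inputs of `P` to inputs of `Q` and
preserves the answers. -/
def PolyTimeReducible (P Q : DecisionProblem) : Prop :=
  ∃ f : P.Input → Q.Input,
    Nonempty (Turing.TM2ComputableInPolyTime P.enc.encode Q.enc.encode f) ∧
      ∀ x, P.Question x ↔ Q.Question (f x)

/-- Membership in NP: there are a polynomial `p` and a polynomial-time verifier `V` such that the
answer for `x` is yes iff `V` accepts `x` with some binary certificate of length at most
`p (|x|)`, where `|x|` is the length of the encoding of `x`. -/
def InNP (P : DecisionProblem) : Prop :=
  ∃ (p : Polynomial ℕ) (V : P.Input × List Bool → Bool),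
    Nonempty (Turing.TM2ComputableInPolyTime
      (encodingProd P.enc (encodingList Bool)).encode encodingBoolBool.encode V) ∧
      ∀ x, P.Question x ↔
        ∃ w : List Bool, w.length ≤ p.eval (P.enc.encode x).length ∧ V (x, w) = true

/-! ### Strings for zero-one matrices -/

/-- Write a list of binary rows as one string, with a comma after every row. -/
def encodeRows (rows : List (List Bool)) : List Γ' :=
  rows.flatMap fun r => r.map Γ'.bit ++ [Γ'.comma]

theorem row_inj : ∀ (a b : List Bool) (x y : List Γ'),
    a.map Γ'.bit ++ Γ'.comma :: x = b.map Γ'.bit ++ Γ'.comma :: y → a = b ∧ x = y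
  | [], [], x, y, h => by simpa using h
  | [], _ :: _, x, y, h => by simp at h
  | _ :: _, [], x, y, h => by simp at h
  | a :: as, b :: bs, x, y, h => by
    simp only [List.map_cons, List.cons_append, List.cons.injEq, Γ'.bit.injEq] at h
    obtain ⟨h1, h2⟩ := row_inj as bs x y h.2
    exact ⟨by rw [h.1, h1], h2⟩

theorem encodeRows_injective : Function.Injective encodeRows := by
  intro R
  induction R with
  | nil =>
    intro R' h
    cases R' with
    | nil => rfl
    | cons b bs => simp [encodeRows] at h
  | cons a as ih =>
    intro R' h
    cases R' with
    | nil => simp [encodeRows] at h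
    | cons b bs =>
      simp only [encodeRows, List.flatMap_cons, List.append_assoc, List.singleton_append] at h
      obtain ⟨h1, h2⟩ := row_inj _ _ _ _ h
      rw [h1, ih h2]

/-- An injective map into strings, as an encoding. -/
noncomputable def encodingOfInjective {α Γ : Type} (e : α → List Γ)
    (he : Function.Injective e) : Encoding α Γ where
  encode := e
  decode := Function.partialInv e
  decode_encode := Function.partialInv_left he

/-! ### Graph Isomorphism -/

/-- A finite undirected graph, with its vertices numbered. -/
structure Graph where
  /-- the number of vertices -/
  size : ℕ
  /-- the graph -/
  graph : SimpleGraph (Fin size)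

open Classical in
/-- The rows of the adjacency matrix. -/
noncomputable def Graph.rows (G : Graph) : List (List Bool) :=
  List.ofFn fun i => List.ofFn fun j => decide (G.graph.Adj i j)

theorem Graph.rows_injective : Function.Injective Graph.rows := by
  rintro ⟨n, G⟩ ⟨m, H⟩ h
  have hn : n = m := by simpa [Graph.rows] using congrArg List.length h
  subst hn
  have h' := List.ofFn_injective h
  congr 1
  ext i j
  simpa using congrFun (List.ofFn_injective (congrFun h' i)) j

/-- A graph is encoded by its adjacency matrix. -/
noncomputable def Graph.encoding : Encoding Graph Γ' :=
  encodingOfInjective (fun G => encodeRows G.rows)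
    (encodeRows_injective.comp Graph.rows_injective)

/-- Graph Isomorphism. Input: two finite undirected graphs. Question: is there a bijection of the
vertices that preserves and reflects adjacency? -/
noncomputable def GI : DecisionProblem where
  Input := Graph × Graph
  Alphabet := Γ' ⊕ Γ'
  finite_alphabet := inferInstance
  enc := encodingProd Graph.encoding Graph.encoding
  Question x := Nonempty (x.1.graph ≃g x.2.graph)

/-! ### Itemset Isomorphism -/

/-- The itemsets (sets of subsets) `S` over `D` and `T` over `E` are isomorphic: some bijection
`J : D → E` satisfies `{J(I) | I ∈ S} = T`. -/
def ItemsetIsomorphic {D E : Type} [DecidableEq D] [DecidableEq E]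
    (S : Finset (Finset D)) (T : Finset (Finset E)) : Prop :=
  ∃ J : D ≃ E, S.image (fun I => I.image J) = T

/-- A finite itemset as an input: the domain is numbered, and the (distinct) items are listed in
some order. -/
structure Itemset where
  /-- the number of elements of the domain -/
  dom : ℕ
  /-- the items -/
  items : List (Finset (Fin dom))
  nodup : items.Nodup

/-- The underlying set of items. -/
def Itemset.toFinset (S : Itemset) : Finset (Finset (Fin S.dom)) :=
  S.items.toFinset

/-- The matrix representation: one binary row of length `dom` for each item. A leading row
of `dom` ones records the domain (there may be no items). -/
def Itemset.rows (S : Itemset) : List (List Bool) :=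
  List.replicate S.dom true :: S.items.map fun I => List.ofFn fun d => decide (d ∈ I)

theorem Itemset.rows_injective : Function.Injective Itemset.rows := by
  rintro ⟨n, A, hA⟩ ⟨m, B, hB⟩ h
  simp only [Itemset.rows, List.cons.injEq] at h
  obtain ⟨h1, h2⟩ := h
  have hn : n = m := by simpa using congrArg List.length h1
  subst hn
  have : A = B := by
    refine List.map_injective_iff.2 ?_ h2
    intro I I' hI
    ext d
    simpa using congrFun (List.ofFn_injective hI) d
  subst this
  rfl

/-- An itemset is encoded by its matrix. -/
noncomputable def Itemset.encoding : Encoding Itemset Γ' :=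
  encodingOfInjective (fun S => encodeRows S.rows)
    (encodeRows_injective.comp Itemset.rows_injective)

/-- Itemset Isomorphism. Input: two itemsets over finite domains. Question: are they isomorphic? -/
noncomputable def II : DecisionProblem where
  Input := Itemset × Itemset
  Alphabet := Γ' ⊕ Γ'
  finite_alphabet := inferInstance
  enc := encodingProd Itemset.encoding Itemset.encoding
  Question x := ItemsetIsomorphic x.1.toFinset x.2.toFinset

end IsoComplexity

/-! A graph is sent to the itemset of its edges, over the domain of all its vertices. A bijection of
the vertices carries edges to edges exactly if it is a graph isomorphism
(`Graph.edgeItemset_isomorphic_iff`), which gives GI ≤ II.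

For II ≤ GI an itemset becomes the bipartite incidence graph of items and elements, together with a
root that is adjacent to all elements and lies in a triangle with two further vertices. No item or
element lies in a triangle, and of these vertices only the elements have a neighbour in one. Hence
every isomorphism respects items and elements, and its restriction to the elements is an itemset
isomorphism (`incidenceGraph_iso_iff`). In the matrix encoding the header row of ones serves as the
row of the root.

For NP, two itemsets are isomorphic iff their matrices agree up to permutations of rows and columns
(`Itemset.isomorphic_iff_exists_perm`). The certificate is not a permutation but a script of bits:
each bit moves the first column to a second matrix as a row, or rotates the columns, or, when no
columns are left, makes the transposed matrix the current one. Two transpositions realise any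
permutation of columns and rows. Conversely, no script can reach the second itemset's matrix in its
original orientation unless that matrix is such a rearrangement (`Sheet.exists_foldl_iff`), so
certificates need no validity check.

Running times are established in a small language of stack programs with loops. `Runs` counts loop
tests, `Runs.sound` transfers the count to steps of a `TM2` machine, and `Runs.scan` is the rule for
loops that consume a list. The theorems `runs_edgeProg`, `runs_incidenceProg` and `runs_verifyProg`
then give the result and the cost of the three machines. -/

namespace IsoComplexity

open Computability Turing

/-! ### A structured language for stack machines -/

/-- The names of the work stacks. -/
inductive Work
  | x | y | a | b | c | t | u | c₀ | c₁ | c₂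
  deriving DecidableEq

instance : Fintype Work :=
  ⟨{.x, .y, .a, .b, .c, .t, .u, .c₀, .c₁, .c₂}, fun k => by cases k <;> decide⟩

/-- The names of all stacks. -/
inductive Stk
  | inp
  | out
  | w (i : Work)
  deriving DecidableEq, Fintype

/-- The alphabets of the stacks: `A` for the input, `B` for the output. -/
abbrev Sym (A B : Type) : Stk → Type
  | .inp => A
  | .out => B
  | .w _ => Γ'

/-- The contents of the work stacks. -/
@[ext] structure Tapes where
  x : List Γ' := []
  y : List Γ' := []
  a : List Γ' := []
  b : List Γ' := []
  c : List Γ' := []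
  t : List Γ' := []
  u : List Γ' := []
  c₀ : List Γ' := []
  c₁ : List Γ' := []
  c₂ : List Γ' := []

/-- The contents of a work stack. -/
def Tapes.get (m : Tapes) : Work → List Γ'
  | .x => m.x
  | .y => m.y
  | .a => m.a
  | .b => m.b
  | .c => m.c
  | .t => m.t
  | .u => m.u
  | .c₀ => m.c₀
  | .c₁ => m.c₁
  | .c₂ => m.c₂

/-- Replace the contents of a work stack. -/
def Tapes.set (m : Tapes) (k : Work) (l : List Γ') : Tapes :=
  match k with
  | .x => { m with x := l }
  | .y => { m with y := l }
  | .a => { m with a := l }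
  | .b => { m with b := l }
  | .c => { m with c := l }
  | .t => { m with t := l }
  | .u => { m with u := l }
  | .c₀ => { m with c₀ := l }
  | .c₁ => { m with c₁ := l }
  | .c₂ => { m with c₂ := l }

@[simp] theorem Tapes.get_set (m : Tapes) (k : Work) (l : List Γ') : (m.set k l).get k = l := by
  cases k <;> rfl

theorem Tapes.get_set_ne (m : Tapes) {k k' : Work} (h : k' ≠ k) (l : List Γ') :
    (m.set k l).get k' = m.get k' := by
  cases k <;> cases k' <;> first | rfl | exact absurd rfl h

@[simp] theorem Tapes.set_set (m : Tapes) (k : Work) (l l' : List Γ') :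
    (m.set k l).set k l' = m.set k l' := by
  cases k <;> rfl

@[simp] theorem Tapes.set_get (m : Tapes) (k : Work) : m.set k (m.get k) = m := by
  cases k <;> rfl

theorem Tapes.set_comm (m : Tapes) {k k' : Work} (h : k ≠ k') (l l' : List Γ') :
    (m.set k l).set k' l' = (m.set k' l').set k l := by
  cases k <;> cases k' <;> first | rfl | exact absurd rfl h

/-- The contents of all stacks. -/
structure Mem (A B : Type) where
  inp : List A
  out : List B
  tapes : Tapes

variable {A B : Type}

/-- The contents of a stack. -/
def Mem.get (m : Mem A B) : (k : Stk) → List (Sym A B k)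
  | .inp => m.inp
  | .out => m.out
  | .w i => m.tapes.get i

/-- Replace the contents of a stack. -/
def Mem.set (m : Mem A B) : (k : Stk) → List (Sym A B k) → Mem A B
  | .inp, l => { m with inp := l }
  | .out, l => { m with out := l }
  | .w i, l => { m with tapes := m.tapes.set i l }

/-- This bridges the machine's view of the stacks, a dependent function changed by
`Function.update`, and the record view, on which `simp` can compute. -/
theorem Mem.update_get (m : Mem A B) (k : Stk) (l : List (Sym A B k)) :
    Function.update m.get k l = (m.set k l).get := by
  funext k'
  by_cases h : k' = k
  · subst h
    cases k' <;> simp [Mem.get, Mem.set]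
  · rw [Function.update_of_ne h]
    cases k <;> cases k' <;> first | rfl | exact absurd rfl h | skip
    exact (Tapes.get_set_ne _ (fun e => h (congrArg Stk.w e)) _).symm

/-- The internal state of the machines: three registers for symbols, two flags, and a tag. -/
structure Reg where
  r : Option Γ' := none
  q : Option Γ' := none
  p : Option Γ' := none
  f : Bool := false
  g : Bool := false
  tag : Fin 3 := 0

noncomputable instance : Fintype Reg :=
  Fintype.ofInjective (fun v : Reg => (v.r, v.q, v.p, v.f, v.g, v.tag)) fun v v' h => by
    cases v; cases v'; simpa using h

/-- Elementary operations: a push (which depends on the internal state), a pop, and an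
update of the internal state. -/
inductive Op (A B : Type)
  | push (k : Stk) (f : Reg → Option (Sym A B k))
  | pop (k : Stk) (f : Reg → Option (Sym A B k) → Reg)
  | load (f : Reg → Reg)

/-- The effect of an elementary operation. -/
def Op.run (s : Reg × Mem A B) : Op A B → Reg × Mem A B
  | .push k f => match f s.1 with
    | none => s
    | some a => (s.1, s.2.set k (a :: s.2.get k))
  | .pop k f => (f s.1 (s.2.get k).head?, s.2.set k (s.2.get k).tail)
  | .load f => (f s.1, s.2)

/-- Structured programs. -/
inductive Prog (A B : Type)
  | block (l : List (Op A B))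
  | seq (p q : Prog A B)
  | loop (c : Reg → Bool) (p : Prog A B)

/-- `Runs p s n s'`: started in `s`, the program `p` ends in `s'` after at most `n` loop tests. -/
inductive Runs : Prog A B → Reg × Mem A B → ℕ → Reg × Mem A B → Prop
  | block {l s s'} : l.foldl Op.run s = s' → Runs (.block l) s 0 s'
  | seq {p q s m s' n s''} : Runs p s m s' → Runs q s' n s'' → Runs (.seq p q) s (m + n) s''
  | done {c p s} : c s.1 = false → Runs (.loop c p) s 1 s
  | step {c p s m s' n s''} : c s.1 = true → Runs p s m s' → Runs (.loop c p) s' n s'' →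
      Runs (.loop c p) s (m + n + 1) s''
  | mono {p s m n s'} : Runs p s m s' → m ≤ n → Runs p s n s'

/-- The labels needed by a program: one for each loop. -/
def Prog.Label : Prog A B → Type
  | .block _ => Empty
  | .seq p q => p.Label ⊕ q.Label
  | .loop _ p => Option p.Label

/-- A program has finitely many labels. -/
@[reducible] noncomputable def Prog.labelFintype : (p : Prog A B) → Fintype p.Label
  | .block _ => inferInstanceAs (Fintype Empty)
  | .seq p q =>
    letI := p.labelFintype
    letI := q.labelFintype
    inferInstanceAs (Fintype (p.Label ⊕ q.Label))
  | .loop _ p =>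
    letI := p.labelFintype
    inferInstanceAs (Fintype (Option p.Label))

/-! ### Compilation of structured programs to `TM2` machines -/

section Compile

variable [Inhabited A] [Inhabited B] {L : Type}

instance (k : Stk) : Inhabited (Sym A B k) :=
  match k with
  | .inp => inferInstanceAs (Inhabited A)
  | .out => inferInstanceAs (Inhabited B)
  | .w _ => inferInstanceAs (Inhabited Γ')

/-- An elementary operation as a statement, with a continuation. -/
def Op.toStmt (o : Op A B) (k : TM2.Stmt (Sym A B) L Reg) : TM2.Stmt (Sym A B) L Reg :=
  match o with
  | .push i f => .branch (fun v => (f v).isSome) (.push i (fun v => (f v).getD default) k) k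
  | .pop i f => .pop i f k
  | .load f => .load f k

/-- A program as a statement, with a continuation. -/
def Prog.toStmt : (p : Prog A B) → (p.Label → L) → TM2.Stmt (Sym A B) L Reg →
    TM2.Stmt (Sym A B) L Reg
  | .block l, _, k => l.foldr Op.toStmt k
  | .seq p q, e, k => p.toStmt (fun l => e (.inl l)) (q.toStmt (fun l => e (.inr l)) k)
  | .loop _ _, e, _ => .goto fun _ => e none

/-- The statements at the labels of a program, with a continuation. -/
def Prog.code : (p : Prog A B) → (p.Label → L) → TM2.Stmt (Sym A B) L Reg →
    p.Label → TM2.Stmt (Sym A B) L Reg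
  | .seq p q, e, k, .inl l => p.code (fun l => e (.inl l)) (q.toStmt (fun l => e (.inr l)) k) l
  | .seq _ q, e, k, .inr l => q.code (fun l => e (.inr l)) k l
  | .loop c p, e, k, none =>
    .branch c (p.toStmt (fun l => e (some l)) (.goto fun _ => e none)) k
  | .loop _ p, e, _, some l => p.code (fun l => e (some l)) (.goto fun _ => e none) l

theorem Op.stepAux_toStmt (o : Op A B) (k : TM2.Stmt (Sym A B) L Reg) (s : Reg × Mem A B) :
    TM2.stepAux (o.toStmt k) s.1 s.2.get = TM2.stepAux k (o.run s).1 (o.run s).2.get := by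
  cases o with
  | push i f =>
    simp only [Op.toStmt, TM2.stepAux, Op.run]
    cases h : f s.1 <;> simp [Mem.update_get]
  | pop i f => simp [Op.toStmt, Op.run, Mem.update_get]
  | load f => rfl

theorem Op.stepAux_foldr (l : List (Op A B)) (k : TM2.Stmt (Sym A B) L Reg) (s : Reg × Mem A B) :
    TM2.stepAux (l.foldr Op.toStmt k) s.1 s.2.get =
      TM2.stepAux k (l.foldl Op.run s).1 (l.foldl Op.run s).2.get := by
  induction l generalizing s with
  | nil => rfl
  | cons o l ih => rw [List.foldr_cons, Op.stepAux_toStmt, ih, List.foldl_cons]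

/-- Straight-line code is fused into a single statement, so the only jumps are those to loop heads,
and one machine step corresponds to one loop test. The continuation `k` varies in the induction
because each part of a program is compiled together with what follows it. -/
theorem Runs.sound {p : Prog A B} {s s' : Reg × Mem A B} {n : ℕ} (h : Runs p s n s')
    (M : L → TM2.Stmt (Sym A B) L Reg) (e : p.Label → L) (k : TM2.Stmt (Sym A B) L Reg)
    (hM : ∀ l, M (e l) = p.code e k l) :
    ∃ j ≤ n, (flip bind (TM2.step M))^[j] (some (TM2.stepAux (p.toStmt e k) s.1 s.2.get)) =
      some (TM2.stepAux k s'.1 s'.2.get) := by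
  induction h generalizing k with
  | block h =>
    subst h
    exact ⟨0, le_rfl, congrArg some (Op.stepAux_foldr _ _ _)⟩
  | @seq p q s m s' n s'' h₁ h₂ ih₁ ih₂ =>
    obtain ⟨i, hi, h₁⟩ := ih₁ (fun l => e (.inl l)) (q.toStmt (fun l => e (.inr l)) k)
      fun l => hM (.inl l)
    obtain ⟨j, hj, h₂⟩ := ih₂ (fun l => e (.inr l)) k fun l => hM (.inr l)
    refine ⟨j + i, by lia, ?_⟩
    rw [Function.iterate_add_apply]
    exact (congrArg _ h₁).trans h₂
  | @done c p s h =>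
    refine ⟨1, le_rfl, ?_⟩
    have := hM none
    simp [Prog.toStmt, flip, this, Prog.code, h]
  | @step c p s m s' n s'' h h₁ h₂ ih₁ ih₂ =>
    obtain ⟨i, hi, h₁⟩ := ih₁ (fun l => e (some l)) (.goto fun _ => e none) fun l => hM (some l)
    obtain ⟨j, hj, h₂⟩ := ih₂ e k hM
    refine ⟨j + i + 1, by lia, ?_⟩
    have h₀ : (flip bind (TM2.step M))
        (some (TM2.stepAux ((Prog.loop c p).toStmt e k) s.1 s.2.get)) =
        some (TM2.stepAux (p.toStmt (fun l => e (some l)) (.goto fun _ => e none)) s.1 s.2.get) := by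
      have := hM none
      simp [Prog.toStmt, flip, this, Prog.code, h]
    rw [Function.iterate_add_apply, Function.iterate_one, h₀, Function.iterate_add_apply, h₁]
    exact h₂
  | mono h hmn ih =>
    obtain ⟨j, hj, h⟩ := ih e k hM
    exact ⟨j, hj.trans hmn, h⟩

/-- The machine that executes a program. -/
noncomputable def Prog.machine [Fintype A] (p : Prog A B) : FinTM2 :=
  letI := p.labelFintype
  { K := Stk
    k₀ := .inp
    k₁ := .out
    Γ := Sym A B
    Γk₀Fin := inferInstanceAs (Fintype A)
    Λ := Option p.Label
    main := none
    σ := Reg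
    initialState := {}
    m := fun
      | none => p.toStmt some .halt
      | some l => p.code some .halt l }

/-- A function is computable in polynomial time if a program computes it with polynomially many
loop tests. -/
theorem computableInPolyTime_of_runs [Fintype A] {α β : Type} {ea : α → List A} {eb : β → List B}
    {f : α → β} (p : Prog A B) (time : Polynomial ℕ)
    (h : ∀ x, Runs p ({}, ⟨ea x, [], {}⟩) (time.eval (ea x).length) ({}, ⟨[], eb (f x), {}⟩)) :
    Nonempty (TM2ComputableInPolyTime ea eb f) := by
  choose j hj hj' using fun x => (h x).sound (p.machine.m) some .halt fun l => rfl
  -- The additional step is the one that leaves `main`. The final state must be blank apart from the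
  -- output because a halting configuration of the machine is compared with `haltList`; this is why
  -- all programs clean up after themselves.
  refine ⟨{ tm := p.machine, inputAlphabet := Equiv.refl A, outputAlphabet := Equiv.refl B,
            time := time + 1, outputsFun := fun x => ⟨⟨j x + 1, ?_⟩, by simpa using hj x⟩ }⟩
  rw [Function.iterate_add_apply, Function.iterate_one]
  have h₀ : (flip bind p.machine.step) (some (initList p.machine (List.map id (ea x)))) =
      some (TM2.stepAux (p.toStmt some .halt) {} (Mem.get ⟨ea x, [], {}⟩)) := by
    refine congrArg (fun S => some (TM2.stepAux (p.toStmt some .halt) {} S)) ?_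
    funext k
    rcases k with _ | _ | (_ | _ | _ | _ | _ | _ | _ | _ | _ | _) <;> first | rfl | exact List.map_id _
  refine (congrArg _ h₀).trans ((hj' x).trans ?_)
  refine congrArg (fun S => some (TM2.Cfg.mk none ({} : Reg) S)) ?_
  funext k
  rcases k with _ | _ | (_ | _ | _ | _ | _ | _ | _ | _ | _ | _) <;>
    first | rfl | exact (List.map_id _).symm

end Compile

attribute [simp] Op.run Mem.get Mem.set
attribute [simp] Tapes.get.eq_1 Tapes.get.eq_2 Tapes.get.eq_3 Tapes.get.eq_4 Tapes.get.eq_5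
  Tapes.get.eq_6 Tapes.get.eq_7 Tapes.get.eq_8 Tapes.get.eq_9 Tapes.get.eq_10
attribute [simp] Tapes.set.eq_1 Tapes.set.eq_2 Tapes.set.eq_3 Tapes.set.eq_4 Tapes.set.eq_5
  Tapes.set.eq_6 Tapes.set.eq_7 Tapes.set.eq_8 Tapes.set.eq_9 Tapes.set.eq_10

/-! ### Basic programs -/

theorem Runs.seq' {p q : Prog A B} {s s' s'' : Reg × Mem A B} {m n k : ℕ} (h₁ : Runs p s m s')
    (h₂ : Runs q s' n s'') (hk : m + n ≤ k) : Runs (.seq p q) s k s'' :=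
  (h₁.seq h₂).mono hk

theorem Runs.cast {p : Prog A B} {s s' s'' : Reg × Mem A B} {n : ℕ} (h : Runs p s n s')
    (e : s' = s'') : Runs p s n s'' :=
  e ▸ h

theorem Runs.cast' {p : Prog A B} {s s' s'' : Reg × Mem A B} {n : ℕ} (h : Runs p s n s')
    (e : s = s'') : Runs p s'' n s' :=
  e ▸ h

/-- A loop that consumes a list: `I pre suf` is the state when the part `pre` has been consumed
and the part `suf` is left. -/
theorem Runs.scan {α : Type*} {c : Reg → Bool} {p : Prog A B} {n : ℕ}
    (I : List α → List α → Reg × Mem A B) (l : List α) (hnil : c (I l []).1 = false)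
    (hc : ∀ pre a suf, l = pre ++ a :: suf → c (I pre (a :: suf)).1 = true)
    (hp : ∀ pre a suf, l = pre ++ a :: suf → Runs p (I pre (a :: suf)) n (I (pre ++ [a]) suf)) :
    Runs (.loop c p) (I [] l) (l.length * (n + 1) + 1) (I l []) := by
  suffices h : ∀ suf pre, l = pre ++ suf →
      Runs (.loop c p) (I pre suf) (suf.length * (n + 1) + 1) (I l []) from h l [] rfl
  intro suf
  induction suf with
  | nil =>
    rintro pre rfl
    rw [List.append_nil] at hnil ⊢
    simpa using Runs.done hnil
  | cons a suf ih =>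
    intro pre h
    refine (Runs.step (hc _ _ _ h) (hp _ _ _ h) (ih (pre ++ [a]) (by simp [h]))).mono ?_
    rw [List.length_cons]
    exact le_of_eq (by ring)

/-- Pop a work stack into the first register. -/
def popR (k : Work) : Op A B := .pop (.w k) fun v a => { v with r := a }

/-- Pop a work stack into the second register. -/
def popQ (k : Work) : Op A B := .pop (.w k) fun v a => { v with q := a }

/-- Pop a work stack into the third register. -/
def popP (k : Work) : Op A B := .pop (.w k) fun v a => { v with p := a }

/-- Push the symbol in the first register (if any). -/
def pushR (k : Work) : Op A B := .push (.w k) fun v => v.r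

/-- Push the symbol in the second register (if any). -/
def pushQ (k : Work) : Op A B := .push (.w k) fun v => v.q

/-- Push the symbol in the third register (if any). -/
def pushP (k : Work) : Op A B := .push (.w k) fun v => v.p

/-- Push a fixed symbol. -/
def pushS (k : Work) (a : Γ') : Op A B := .push (.w k) fun _ => some a

/-- Push a fixed symbol if the second flag is set. -/
def pushG (k : Work) (a : Γ') : Op A B := .push (.w k) fun v => if v.g then some a else none

attribute [simp] popR popQ popP pushR pushQ pushP pushS pushG

/-- Move the contents of a work stack to another one, in reverse order. -/
def move (k k' : Work) : Prog A B :=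
  .seq (.block [popP k]) (.loop (fun v => v.p.isSome) (.block [pushP k', popP k]))

/-- A stack can be inspected only by popping it, so a loop keeps one symbol of lookahead: the
invariant shows `suf.head?` in a register and `suf.tail` on the stack. The later loops that read a
stack follow the same pattern. -/
theorem runs_move (k k' : Work) (h : k ≠ k') (v : Reg) (i : List A) (o : List B) (m : Tapes) :
    Runs (move k k') (v, ⟨i, o, m⟩) ((m.get k).length + 1)
      ({ v with p := none },
        ⟨i, o, (m.set k []).set k' ((m.get k).reverse ++ m.get k')⟩) := by
  refine Runs.seq' (.block rfl) (n := (m.get k).length + 1) ?_ (by lia)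
  have := Runs.scan (A := A) (B := B) (c := fun v => v.p.isSome)
    (p := .block [pushP k', popP k]) (n := 0)
    (fun pre suf => ({ v with p := suf.head? },
      ⟨i, o, (m.set k suf.tail).set k' (pre.reverse ++ m.get k')⟩)) (m.get k) rfl
    (fun _ _ _ _ => rfl) fun pre a suf _ => .block (by
      simp [Tapes.get_set_ne _ h, Tapes.set_comm _ h.symm])
  -- Before the loop nothing has been added to `k'`; rewriting its contents as those of the modified
  -- tapes lets `Tapes.set_get` remove the vacuous update.
  simpa [← Tapes.get_set_ne m h.symm (m.get k).tail] using this

/-- Empty a work stack. -/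
def clear (k : Work) : Prog A B :=
  .seq (.block [popP k]) (.loop (fun v => v.p.isSome) (.block [popP k]))

theorem runs_clear (k : Work) (v : Reg) (i : List A) (o : List B) (m : Tapes) :
    Runs (clear k) (v, ⟨i, o, m⟩) ((m.get k).length + 1)
      ({ v with p := none }, ⟨i, o, m.set k []⟩) := by
  refine Runs.seq' (.block rfl) (n := (m.get k).length + 1) ?_ (by lia)
  have := Runs.scan (A := A) (B := B) (c := fun v => v.p.isSome)
    (p := .block [popP k]) (n := 0)
    (fun pre suf => ({ v with p := suf.head? }, ⟨i, o, m.set k suf.tail⟩)) (m.get k) rfl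
    (fun _ _ _ _ => rfl) fun pre a suf _ => .block (by simp)
  simpa using this

/-- Push as many zeros on the stack `y` as there are symbols on the stack `k`, provided that
the second flag is set. -/
def zeros (k : Work) : Prog A B :=
  .seq (.block [popP k]) (.seq
    (.loop (fun v => v.p.isSome) (.block [pushP .u, pushG .y (.bit false), popP k]))
    (move .u k))

/-- The symbols of `k` are parked on `u` and then moved back, so the counter survives; this accounts
for the factor two and for the condition that `u` be empty. -/
theorem runs_zeros (k : Work) (hy : k ≠ .y) (hu : k ≠ .u) (v : Reg) (i : List A) (o : List B)
    (m : Tapes) (hm : m.u = []) :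
    Runs (zeros k) (v, ⟨i, o, m⟩) (2 * (m.get k).length + 2)
      ({ v with p := none },
        ⟨i, o, m.set .y ((if v.g then List.replicate (m.get k).length (.bit false) else []) ++
          m.y)⟩) := by
  have h := Runs.scan (A := A) (B := B) (c := fun v => v.p.isSome)
    (p := .block [pushP .u, pushG .y (.bit false), popP k]) (n := 0)
    (fun pre suf => ({ v with p := suf.head? },
      ⟨i, o, ((m.set k suf.tail).set .u pre.reverse).set .y
        ((if v.g then List.replicate pre.length (.bit false) else []) ++ m.y)⟩))
    (m.get k) rfl (fun _ _ _ _ => rfl) fun pre a suf _ => .block (by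
      cases hg : v.g <;> cases k <;> simp_all [List.replicate_succ])
  have h' := runs_move (A := A) (B := B) .u k hu.symm { v with p := none } i o
    (((m.set k []).set .u (m.get k).reverse).set .y
        ((if v.g then List.replicate (m.get k).length (.bit false) else []) ++ m.y))
  refine Runs.seq' (.block ?_) (h.seq (h'.cast ?_)) ?_
  · cases k <;> simp_all
  · cases k <;> simp_all
  · simp only [ne_eq, reduceCtorEq, not_false_eq_true, Tapes.get_set_ne, Tapes.get_set,
      List.length_reverse]
    lia

/-- Pop the input into the first register, and record its tag. -/
def popInp (e : A → Γ' × Fin 3) : Op A B :=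
  .pop .inp fun v a => { v with r := a.map fun s => (e s).1, tag := (a.map fun s => (e s).2).getD 0 }

/-- Push the symbol in the first register if it has the given tag. -/
def pushTag (i : Fin 3) (k : Work) : Op A B :=
  .push (.w k) fun v => if v.tag = i then v.r else none

attribute [simp] popInp pushTag

/-- Distribute the input to three stacks, according to the tags of the symbols. -/
def split (e : A → Γ' × Fin 3) : Prog A B :=
  .seq (.block [popInp e]) (.loop (fun v => v.r.isSome)
    (.block [pushTag 0 .a, pushTag 1 .b, pushTag 2 .c, popInp e]))

theorem runs_split (e : A → Γ' × Fin 3) (l : List A) (o : List B) :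
    Runs (split e) ({}, ⟨l, o, {}⟩) (l.length + 1) ({}, ⟨[], o,
      { a := ((l.filter fun s => (e s).2 = 0).map fun s => (e s).1).reverse
        b := ((l.filter fun s => (e s).2 = 1).map fun s => (e s).1).reverse
        c := ((l.filter fun s => (e s).2 = 2).map fun s => (e s).1).reverse }⟩) := by
  refine Runs.seq' (.block rfl) (n := l.length + 1) ?_ (by lia)
  have := Runs.scan (A := A) (B := B) (c := fun v => v.r.isSome)
    (p := .block [pushTag 0 .a, pushTag 1 .b, pushTag 2 .c, popInp e]) (n := 0)
    (fun pre suf => ({ r := suf.head?.map fun s => (e s).1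
                       tag := (suf.head?.map fun s => (e s).2).getD 0 },
      ⟨suf.tail, o, { a := ((pre.filter fun s => (e s).2 = 0).map fun s => (e s).1).reverse
                      b := ((pre.filter fun s => (e s).2 = 1).map fun s => (e s).1).reverse
                      c := ((pre.filter fun s => (e s).2 = 2).map fun s => (e s).1).reverse }⟩))
    l rfl (fun _ _ _ _ => rfl) fun pre s suf _ => .block (by
      generalize hs : e s = z
      obtain ⟨z, i⟩ := z
      fin_cases i <;> simp [hs])
  simpa using this

/-- Move the stack `y` to the output, in reverse order. -/
def moveOut (f : Γ' → B) : Prog A B :=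
  .seq (.block [popP .y]) (.loop (fun v => v.p.isSome)
    (.block [.push .out fun v => v.p.map f, popP .y]))

theorem runs_moveOut (f : Γ' → B) (v : Reg) (i : List A) (o : List B) (m : Tapes) :
    Runs (moveOut f) (v, ⟨i, o, m⟩) (m.y.length + 1)
      ({ v with p := none }, ⟨i, (m.y.map f).reverse ++ o, { m with y := [] }⟩) := by
  refine Runs.seq' (.block rfl) (n := m.y.length + 1) ?_ (by lia)
  have := Runs.scan (A := A) (B := B) (c := fun v => v.p.isSome)
    (p := .block [.push .out fun v => v.p.map f, popP .y]) (n := 0)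
    (fun pre suf => ({ v with p := suf.head? },
      ⟨i, (pre.map f).reverse ++ o, { m with y := suf.tail }⟩)) m.y rfl
    (fun _ _ _ _ => rfl) fun pre a suf _ => .block (by simp)
  simpa using this

theorem eval_mono (p : Polynomial ℕ) {m n : ℕ} (h : m ≤ n) : p.eval m ≤ p.eval n := by
  simp only [Polynomial.eval_eq_sum, Polynomial.sum]
  exact Finset.sum_le_sum fun i _ => Nat.mul_le_mul_left _ (Nat.pow_le_pow_left h i)

/-! ### Machines that work on both components of a pair -/

/-- Apply a program to both components of a pair. -/
def pairProg (core : Prog (Γ' ⊕ Γ') (Γ' ⊕ Γ')) : Prog (Γ' ⊕ Γ') (Γ' ⊕ Γ') :=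
  .seq (split (Sum.elim (fun s => (s, 0)) fun s => (s, 1)))
    (.seq (move .b .x) (.seq core (.seq (moveOut .inr)
      (.seq (move .a .x) (.seq core (moveOut .inl))))))

/-- The output is built by pushing, so the second component has to be treated first. `core` leaves
its result reversed on `y`, and the transfer to the output restores the order. The bound `size` is
needed because that transfer takes time linear in the result. -/
theorem computableInPolyTime_pair {α β : Type} {ea : α → List Γ'} {eb : β → List Γ'} {f : α → β}
    (core : Prog (Γ' ⊕ Γ') (Γ' ⊕ Γ')) (time size : Polynomial ℕ)
    (hcore : ∀ z o a b, Runs core ({}, ⟨[], o, { x := ea z, a := a, b := b }⟩)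
      (time.eval (ea z).length) ({}, ⟨[], o, { y := (eb (f z)).reverse, a := a, b := b }⟩))
    (hsize : ∀ z, (eb (f z)).length ≤ size.eval (ea z).length) :
    Nonempty (TM2ComputableInPolyTime
      (fun z : α × α => (ea z.1).map Sum.inl ++ (ea z.2).map Sum.inr)
      (fun z : β × β => (eb z.1).map Sum.inl ++ (eb z.2).map Sum.inr) (Prod.map f f)) := by
  have : Inhabited (Γ' ⊕ Γ') := ⟨.inl default⟩
  refine computableInPolyTime_of_runs (pairProg core) (3 * .X + 2 * time + 2 * size + 5) ?_
  rintro ⟨z, w⟩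
  have h₁ := runs_split (B := Γ' ⊕ Γ') (Sum.elim (fun s => (s, 0)) fun s => (s, 1))
    ((ea z).map Sum.inl ++ (ea w).map Sum.inr) []
  simp only [List.filter_append, List.filter_map, Function.comp_def, Sum.elim_inl, Sum.elim_inr,
    List.map_append, List.map_map] at h₁
  simp only [decide_true, List.filter_true, List.map_id', show (1 : Fin 3) ≠ 0 by decide,
    show (0 : Fin 3) ≠ 1 by decide, show (0 : Fin 3) ≠ 2 by decide, show (1 : Fin 3) ≠ 2 by decide,
    decide_false, List.filter_false, List.map_nil, List.append_nil, List.nil_append,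
    List.reverse_nil] at h₁
  have t₁ := eval_mono time (m := (ea z).length) (n := (ea z).length + (ea w).length) (by lia)
  have t₂ := eval_mono time (m := (ea w).length) (n := (ea z).length + (ea w).length) (by lia)
  have t₃ := eval_mono size (m := (ea z).length) (n := (ea z).length + (ea w).length) (by lia)
  have t₄ := eval_mono size (m := (ea w).length) (n := (ea z).length + (ea w).length) (by lia)
  have t₅ := hsize z
  have t₆ := hsize w
  have h₂ : Runs (A := Γ' ⊕ Γ') (B := Γ' ⊕ Γ') (move .b .x)
      ({}, ⟨[], [], { a := (ea z).reverse, b := (ea w).reverse }⟩)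
      ((ea w).length + 1)
      ({}, ⟨[], [], { x := ea w, a := (ea z).reverse }⟩) := by
    simpa using runs_move .b .x (by decide) {} [] [] { a := (ea z).reverse, b := (ea w).reverse }
  have h₃ := hcore w [] (ea z).reverse []
  have h₄ : Runs (A := Γ' ⊕ Γ') (B := Γ' ⊕ Γ') (moveOut .inr)
      ({}, ⟨[], [], { y := (eb (f w)).reverse, a := (ea z).reverse }⟩)
      ((eb (f w)).length + 1) ({}, ⟨[], (eb (f w)).map Sum.inr, { a := (ea z).reverse }⟩) := by
    simpa using runs_moveOut (B := Γ' ⊕ Γ') .inr {} [] []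
      { y := (eb (f w)).reverse, a := (ea z).reverse }
  have h₅ : Runs (A := Γ' ⊕ Γ') (B := Γ' ⊕ Γ') (move .a .x)
      ({}, ⟨[], (eb (f w)).map Sum.inr, { a := (ea z).reverse }⟩)
      ((ea z).length + 1)
      ({}, ⟨[], (eb (f w)).map Sum.inr, { x := ea z }⟩) := by
    simpa using runs_move .a .x (by decide) {} [] _ { a := (ea z).reverse }
  have h₆ := hcore z ((eb (f w)).map Sum.inr) [] []
  have h₇ : Runs (A := Γ' ⊕ Γ') (B := Γ' ⊕ Γ') (moveOut .inl)
      ({}, ⟨[], (eb (f w)).map Sum.inr, { y := (eb (f z)).reverse }⟩)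
      ((eb (f z)).length + 1)
      ({}, ⟨[], (eb (f z)).map Sum.inl ++ (eb (f w)).map Sum.inr, {}⟩) := by
    simpa using runs_moveOut (B := Γ' ⊕ Γ') .inl {} [] _ { y := (eb (f z)).reverse }
  refine (h₁.seq (h₂.seq (h₃.seq (h₄.seq (h₅.seq (h₆.seq h₇)))))).mono ?_
  simp
  lia

/-! ### The itemset of the edges of a graph: the program -/

theorem encodeRows_cons (r : List Bool) (R : List (List Bool)) :
    encodeRows (r :: R) = r.map Γ'.bit ++ Γ'.comma :: encodeRows R := by
  simp [encodeRows]

theorem encodeRows_append (R R' : List (List Bool)) :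
    encodeRows (R ++ R') = encodeRows R ++ encodeRows R' := by
  simp [encodeRows]

@[simp] theorem encodeRows_nil : encodeRows [] = [] := rfl

/-- A number in unary. -/
def unary (n : ℕ) : List Γ' := List.replicate n Γ'.blank

@[simp] theorem length_unary (n : ℕ) : (unary n).length = n := List.length_replicate

@[simp] theorem unary_zero : unary 0 = [] := rfl

theorem unary_succ (n : ℕ) : unary (n + 1) = Γ'.blank :: unary n := rfl

@[simp] theorem reverse_unary (n : ℕ) : (unary n).reverse = unary n := List.reverse_replicate

@[simp] theorem head?_unary_succ (n : ℕ) : (unary (n + 1)).head? = some Γ'.blank := rfl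

@[simp] theorem tail_unary (n : ℕ) : (unary n).tail = unary (n - 1) := by
  cases n <;> rfl

/-- The row with exactly two ones, separated and surrounded by the given numbers of zeros. -/
def edgeRow (j k l : ℕ) : List Bool :=
  List.replicate j false ++ true :: (List.replicate k false ++ true :: List.replicate l false)

/-- Write the row `edgeRow j k l`, for the numbers `j`, `k`, `l` on the stacks `c₁`, `c₀`, `c₂`. -/
def emitEdge : Prog A B :=
  .seq (zeros .c₁) (.seq (.block [pushG .y (.bit true)]) (.seq (zeros .c₀)
    (.seq (.block [pushG .y (.bit true)]) (.seq (zeros .c₂) (.block [pushG .y .comma])))))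

/-- Every push onto `y` is guarded by the flag `g`, so the same code serves edges and non-edges,
within the same time bound. -/
theorem runs_emitEdge (v : Reg) (i : List A) (o : List B) (x y a b p q r : List Γ') :
    Runs emitEdge (v, ⟨i, o, { x := x, y := y, a := a, b := b, c₀ := p, c₁ := q, c₂ := r }⟩)
      (2 * p.length + 2 * q.length + 2 * r.length + 6)
      ({ v with p := none },
        ⟨i, o, { x := x, y := (if v.g then
          (encodeRows [edgeRow q.length p.length r.length]).reverse else []) ++ y
                 a := a, b := b, c₀ := p, c₁ := q, c₂ := r }⟩) := by
  set M : List Γ' → Tapes := fun y => { x := x, y := y, a := a, b := b, c₀ := p, c₁ := q, c₂ := r }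
    with hM
  set w : Reg := { v with p := none }
  set Z : ℕ → List Γ' := fun n => if v.g then List.replicate n (.bit false) else [] with hZ
  set U : Γ' → List Γ' := fun s => if v.g then [s] else [] with hU
  have h₁ : Runs (zeros .c₁) (v, ⟨i, o, M y⟩) _ (w, ⟨i, o, M (Z q.length ++ y)⟩) :=
    runs_zeros .c₁ (by decide) (by decide) v i o (M y) rfl
  have h₂ (s : Γ') (y : List Γ') : Runs (.block [pushG .y s]) (w, ⟨i, o, M y⟩) _
      (w, ⟨i, o, M (U s ++ y)⟩) := .block (by
    cases hg : v.g <;> simp [hU, hM, w, hg])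
  have h₃ (y : List Γ') : Runs (zeros .c₀) (w, ⟨i, o, M y⟩) _ (w, ⟨i, o, M (Z p.length ++ y)⟩) :=
    runs_zeros .c₀ (by decide) (by decide) w i o (M y) rfl
  have h₄ (y : List Γ') : Runs (zeros .c₂) (w, ⟨i, o, M y⟩) _ (w, ⟨i, o, M (Z r.length ++ y)⟩) :=
    runs_zeros .c₂ (by decide) (by decide) w i o (M y) rfl
  refine ((h₁.seq ((h₂ _ _).seq ((h₃ _).seq ((h₂ _ _).seq ((h₄ _).seq (h₂ _ _)))))).cast ?_).mono ?_
  · cases hg : v.g <;> simp [hU, hZ, hM, hg, encodeRows, edgeRow]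
  · simp [hM]
    lia

/-- Test for a bit in the first register. -/
def isBit : Option Γ' → Bool
  | some (.bit _) => true
  | _ => false

@[simp] theorem isBit_bit (b : Bool) : isBit (some (.bit b)) = true := rfl

@[simp] theorem isBit_comma : isBit (some .comma) = false := rfl

@[simp] theorem isBit_none : isBit none = false := rfl

/-- Treat one entry of the adjacency matrix. -/
def edgeEntry : Prog A B :=
  .seq (.block [popQ .c₀, .load fun v => { v with g := decide (v.r = some (.bit true)) && v.q.isSome }])
    (.seq emitEdge (.block [pushQ .c₁, .load fun _ => {}, popR .x]))

/-- At entry `j` of row `i` the counter `c₀` holds the truncated difference `i - j`. Popping it both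
tests `j < i` and leaves `i - 1 - j`, the number of zeros between the two ones. The popped blank is
pushed on `c₁`, which therefore stops growing at the diagonal. -/
theorem runs_edgeEntry (i : List A) (o : List B) (x y a b : List Γ') (e : Bool) (j k l : ℕ) :
    Runs edgeEntry ({ r := some (.bit e) },
        ⟨i, o, { x := x, y := y, a := a, b := b, c₀ := unary k, c₁ := unary j, c₂ := unary l }⟩)
      (2 * (j + k + l) + 6)
      ({ r := x.head? }, ⟨i, o, { x := x.tail
                                  y := (encodeRows (if 0 < k ∧ e then [edgeRow j (k - 1) l]
                                    else [])).reverse ++ y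
                                  a := a, b := b, c₀ := unary (k - 1)
                                  c₁ := unary (if 0 < k then j + 1 else j), c₂ := unary l }⟩) := by
  set v : Reg := { r := some (.bit e), q := (unary k).head?, g := e && decide (0 < k) }
  have h₁ : Runs (A := A) (B := B) (.block [popQ .c₀, .load fun v => { v with
      g := decide (v.r = some (.bit true)) && v.q.isSome }]) ({ r := some (.bit e) },
        ⟨i, o, { x := x, y := y, a := a, b := b, c₀ := unary k, c₁ := unary j, c₂ := unary l }⟩) 0
        (v, ⟨i, o, { x := x, y := y, a := a, b := b, c₀ := unary (k - 1), c₁ := unary j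
                     c₂ := unary l }⟩) := .block (by
    cases k <;> simp [v, unary_succ])
  refine (h₁.seq ((runs_emitEdge _ _ _ _ _ _ _ _ _ _).seq (.block (s' := _) ?_))).mono ?_
  · cases k <;> cases e <;> simp [v, unary_succ]
  · simp
    lia

/-- The items of the row `bs`, with index `i`, of an adjacency matrix: those for its first `m`
entries. -/
def rowEdges (n i : ℕ) (bs : List Bool) (m : ℕ) : List (List Bool) :=
  (List.range m).flatMap fun j =>
    if j < i ∧ bs[j]? = some true then [edgeRow j (i - 1 - j) (n - 1 - i)] else []

/-- Treat one row of the adjacency matrix. -/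
def edgeLine : Prog A B :=
  .seq (.block [popP .c₂, .load fun v => { v with p := none }])
    (.seq (.loop (fun v => isBit v.r) edgeEntry)
      (.seq (move .c₁ .c₀) (.block [pushS .c₀ .blank, popR .x])))

/-- Throughout row `k` the counters `c₀` and `c₁` together hold `k` blanks. As `k < n`, the diagonal
is passed before the row ends and all of them are on `c₁`; moving them back and adding one prepares
the next row. -/
theorem runs_edgeLine (i : List A) (o : List B) (x y a b : List Γ') (bs : List Bool) (n k : ℕ)
    (hn : bs.length = n) (hk : k < n) :
    Runs edgeLine ({ r := (bs.map Γ'.bit ++ Γ'.comma :: x).head? },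
        ⟨i, o, { x := (bs.map Γ'.bit ++ Γ'.comma :: x).tail, y := y, a := a, b := b
                 c₀ := unary k, c₂ := unary (n - k) }⟩)
      (n * (2 * n + 7) + n + 2)
      ({ r := x.head? }, ⟨i, o, { x := x.tail
                                  y := (encodeRows (rowEdges n k bs n)).reverse ++ y
                                  a := a, b := b, c₀ := unary (k + 1)
                                  c₂ := unary (n - (k + 1)) }⟩) := by
  have h := Runs.scan (A := A) (B := B) (c := fun v => isBit v.r) (p := edgeEntry) (n := 2 * n + 6)
    (fun pre suf => ({ r := (suf.map Γ'.bit ++ Γ'.comma :: x).head? },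
        ⟨i, o, { x := (suf.map Γ'.bit ++ Γ'.comma :: x).tail
                 y := (encodeRows (rowEdges n k bs pre.length)).reverse ++ y
                 a := a, b := b, c₀ := unary (k - pre.length), c₁ := unary (min pre.length k)
                 c₂ := unary (n - 1 - k) }⟩)) bs rfl (fun _ _ _ _ => rfl) fun pre e suf hs => by
    have hl := congrArg List.length hs
    rw [List.length_append, List.length_cons] at hl
    refine ((runs_edgeEntry i o (suf.map Γ'.bit ++ Γ'.comma :: x) _ a b e
      (min pre.length k) (k - pre.length) (n - 1 - k)).mono ?_).cast ?_
    · lia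
    · have e₁ : k - pre.length - 1 = k - (pre.length + 1) := by lia
      have e₂ : (if 0 < k - pre.length then min pre.length k + 1 else min pre.length k) =
          min (pre.length + 1) k := by split_ifs <;> lia
      have e₃ : bs[pre.length]? = some e := by simp [hs]
      rw [e₂, e₁, List.length_append, List.length_singleton, rowEdges, rowEdges, List.range_succ,
        List.flatMap_append, encodeRows_append, List.reverse_append, List.append_assoc]
      simp only [List.flatMap_singleton, e₃, Option.some.injEq]
      by_cases hk : pre.length < k
      · rw [min_eq_left hk.le, show k - (pre.length + 1) = k - 1 - pre.length by lia]
        simp [hk]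
      · simp [hk]
  have h₀ : Runs (A := A) (B := B) (.block [popP .c₂, .load fun v => { v with p := none }])
      ({ r := (bs.map Γ'.bit ++ Γ'.comma :: x).head? },
        ⟨i, o, { x := (bs.map Γ'.bit ++ Γ'.comma :: x).tail, y := y, a := a, b := b
                 c₀ := unary k, c₂ := unary (n - k) }⟩) 0
      ({ r := (bs.map Γ'.bit ++ Γ'.comma :: x).head? },
        ⟨i, o, { x := (bs.map Γ'.bit ++ Γ'.comma :: x).tail, y := y, a := a, b := b
                 c₀ := unary k, c₂ := unary (n - 1 - k) }⟩) :=
    .block (by simp [show n - k - 1 = n - 1 - k by lia])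
  have h₁ := runs_move (A := A) (B := B) .c₁ .c₀ (by decide) { r := some .comma } i o
    { x := x, y := (encodeRows (rowEdges n k bs bs.length)).reverse ++ y, a := a, b := b
      c₀ := unary (k - bs.length), c₁ := unary (min bs.length k), c₂ := unary (n - 1 - k) }
  simp only [hn, Nat.sub_eq_zero_of_le hk.le, min_eq_right hk.le, Tapes.get.eq_8, Tapes.get.eq_9,
    Tapes.set.eq_8, Tapes.set.eq_9, reverse_unary, unary_zero, List.append_nil,
    length_unary] at h h₁
  refine (h₀.seq (.seq (h.cast' ?_) (h₁.seq (.block (s' := _) ?_)))).mono ?_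
  · simp [rowEdges]
  · simp [unary_succ, show n - (k + 1) = n - 1 - k by lia]
  · lia

/-- The items of an adjacency matrix: those for its first `m` rows. -/
def matrixEdges (n : ℕ) (R : List (List Bool)) (m : ℕ) : List (List Bool) :=
  (List.range m).flatMap fun i => rowEdges n i (R.getD i []) n

/-- Write the header row, and the number of vertices on the stack `c₂`. -/
def edgeHeader : Prog A B :=
  .seq (.block [popR .x]) (.seq (.loop (fun v => isBit v.r)
    (.block [pushR .t, pushS .y (.bit true), pushS .c₂ .blank, popR .x]))
    (.seq (.block [pushS .y .comma, pushR .x, .load fun _ => {}]) (move .t .x)))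

/-- The header has as many ones as the first row of the matrix has entries. The hypothesis concerns
only the head of `x`, so that the empty matrix, where no comma follows, is covered too. -/
theorem runs_edgeHeader (i : List A) (o : List B) (bs : List Bool) (x a b : List Γ')
    (hx : isBit x.head? = false) :
    Runs edgeHeader ({}, ⟨i, o, { x := bs.map Γ'.bit ++ x, a := a, b := b }⟩)
      (2 * bs.length + 2)
      ({}, ⟨i, o, { x := bs.map Γ'.bit ++ x
                    y := (encodeRows [List.replicate bs.length true]).reverse
                    a := a, b := b, c₂ := unary bs.length }⟩) := by
  have h := Runs.scan (A := A) (B := B) (c := fun v => isBit v.r)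
    (p := .block [pushR .t, pushS .y (.bit true), pushS .c₂ .blank, popR .x]) (n := 0)
    (fun pre suf => ({ r := (suf.map Γ'.bit ++ x).head? },
        ⟨i, o, { x := (suf.map Γ'.bit ++ x).tail
                 y := List.replicate pre.length (.bit true)
                 a := a, b := b, t := (pre.map Γ'.bit).reverse, c₂ := unary pre.length }⟩)) bs
    (by simpa using hx) (fun _ _ _ _ => rfl) fun pre e suf hs =>
      .block (by simp [List.replicate_succ, unary_succ])
  have h₁ := runs_move (A := A) (B := B) .t .x (by decide) {} i o
    { x := x, y := (encodeRows [List.replicate bs.length true]).reverse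
      a := a, b := b, t := (bs.map Γ'.bit).reverse, c₂ := unary bs.length }
  refine (Runs.seq (.block rfl) (h.seq (.seq (.block ?_) (h₁.cast ?_)))).mono ?_
  · cases x <;> simp [encodeRows]
  · simp
  · simp
    lia

/-- From the adjacency matrix of a graph to the matrix of the itemset of its edges. -/
def edgeProg : Prog A B :=
  .seq edgeHeader (.seq (.block [popR .x]) (.seq (.loop (fun v => v.r.isSome) edgeLine)
    (.seq (clear .c₀) (.block [.load fun _ => {}]))))

theorem runs_edgeProg (i : List A) (o : List B) (R : List (List Bool)) (n : ℕ) (a b : List Γ')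
    (hR : R.length = n) (hR' : ∀ r ∈ R, r.length = n) :
    Runs edgeProg ({}, ⟨i, o, { x := encodeRows R, a := a, b := b }⟩)
      (n * (n * (2 * n + 7) + n + 3) + 3 * n + 4)
      ({}, ⟨i, o, { y := (encodeRows (List.replicate n true :: matrixEdges n R n)).reverse
                    a := a, b := b }⟩) := by
  have h₁ : Runs edgeHeader ({}, ⟨i, o, { x := encodeRows R, a := a, b := b }⟩) (2 * n + 2)
      ({}, ⟨i, o, { x := encodeRows R, y := (encodeRows [List.replicate n true]).reverse
                    a := a, b := b, c₂ := unary n }⟩) := by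
    -- A graph without vertices has no first row; its header row is empty.
    cases R with
    | nil =>
      simp only [List.length_nil] at hR
      subst hR
      exact runs_edgeHeader i o [] [] a b rfl
    | cons r R =>
      have := runs_edgeHeader i o r (.comma :: encodeRows R) a b rfl
      rwa [hR' r (by simp), ← encodeRows_cons] at this
  have h := Runs.scan (A := A) (B := B) (c := fun v => v.r.isSome) (p := edgeLine)
    (n := n * (2 * n + 7) + n + 2)
    (fun pre suf => ({ r := (encodeRows suf).head? },
        ⟨i, o, { x := (encodeRows suf).tail
                 y := (encodeRows (List.replicate n true :: matrixEdges n R pre.length)).reverse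
                 a := a, b := b, c₀ := unary pre.length, c₂ := unary (n - pre.length) }⟩)) R rfl
    (fun _ r suf _ => by cases r <;> simp [encodeRows_cons]) fun pre r suf hs => by
    have hl := congrArg List.length hs
    rw [List.length_append, List.length_cons] at hl
    have := runs_edgeLine i o (encodeRows suf)
      (encodeRows (List.replicate n true :: matrixEdges n R pre.length)).reverse a b r n pre.length
      (hR' r (by simp [hs])) (by lia)
    rw [← encodeRows_cons] at this
    refine this.cast ?_
    rw [matrixEdges, matrixEdges, List.length_append, List.length_singleton, List.range_succ,
      List.flatMap_append, ← List.cons_append, encodeRows_append, List.reverse_append]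
    simp [hs]
  have h₂ := runs_clear (A := A) (B := B) .c₀ {} i o
    { y := (encodeRows (List.replicate n true :: matrixEdges n R n)).reverse
      a := a, b := b, c₀ := unary n }
  rw [hR] at h
  refine (h₁.seq (.seq (.block ?_) (h.seq ((h₂.cast' ?_).seq (.block ?_))))).mono ?_
  · simp [matrixEdges, encodeRows]
  · simp
  · simp
  · simp
    lia

/-! ### The itemset of the edges of a graph: correctness -/

theorem ofFn_mem_pair {n : ℕ} {i j : Fin n} (h : j < i) :
    (List.ofFn fun d => decide (d ∈ ({j, i} : Finset (Fin n)))) =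
      edgeRow j (i - 1 - j) (n - 1 - i) := by
  have hi := i.2
  have hj : (j : ℕ) < i := h
  refine List.ext_getElem (by simp [edgeRow]; lia) fun d h₁ h₂ => ?_
  simp only [List.length_ofFn] at h₁
  simp only [List.getElem_ofFn, Finset.mem_insert, Finset.mem_singleton, Fin.ext_iff, edgeRow,
    List.getElem_append, List.getElem_cons, List.length_replicate, List.getElem_replicate]
  split_ifs <;> (simp; lia)

open Classical in
/-- The items of the itemset of the edges of a graph. -/
noncomputable def Graph.edgeItems (G : Graph) : List (Finset (Fin G.size)) :=
  (List.finRange G.size).flatMap fun i => (List.finRange G.size).flatMap fun j =>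
    if j < i ∧ G.graph.Adj i j then [{j, i}] else []

theorem Graph.mem_edgeItems (G : Graph) (I : Finset (Fin G.size)) :
    I ∈ G.edgeItems ↔ ∃ i j, j < i ∧ G.graph.Adj i j ∧ I = {j, i} := by
  simp only [Graph.edgeItems, List.mem_flatMap, List.mem_finRange, true_and]
  refine exists_congr fun i => exists_congr fun j => ?_
  split_ifs with h <;> simp [h]
  tauto

/-- An unordered pair determines its larger and its smaller member. -/
theorem pair_eq_pair {n : ℕ} {i j i' j' : Fin n} (h : j < i) (h' : j' < i')
    (e : ({j, i} : Finset (Fin n)) = {j', i'}) : i = i' ∧ j = j' := by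
  have h₁ := Finset.ext_iff.1 e i
  have h₂ := Finset.ext_iff.1 e j
  have h₃ := Finset.ext_iff.1 e i'
  simp only [Finset.mem_insert, Finset.mem_singleton] at h₁ h₂ h₃
  grind

/-- Each edge is listed only at its larger endpoint, so by `pair_eq_pair` an item determines its
place in both nested lists. -/
theorem Graph.nodup_edgeItems (G : Graph) : G.edgeItems.Nodup := by
  have key : ∀ (i j : Fin G.size) (I : Finset (Fin G.size)), I ∈ (open Classical in
      if j < i ∧ G.graph.Adj i j then [({j, i} : Finset (Fin G.size))] else []) →
      j < i ∧ I = {j, i} := by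
    intro i j I h
    split_ifs at h with h'
    · exact ⟨h'.1, by simpa using h⟩
    · simp at h
  refine List.nodup_flatMap.2 ⟨fun i _ => List.nodup_flatMap.2 ⟨fun j _ => ?_, ?_⟩, ?_⟩
  · split_ifs <;> simp
  · refine (List.nodup_finRange _).imp fun hne I h h' => hne ?_
    obtain ⟨h₁, rfl⟩ := key _ _ _ h
    obtain ⟨h₂, e⟩ := key _ _ _ h'
    exact (pair_eq_pair h₁ h₂ e).2
  · refine (List.nodup_finRange _).imp fun hne I h h' => hne ?_
    obtain ⟨j, _, h⟩ := List.mem_flatMap.1 h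
    obtain ⟨j', _, h'⟩ := List.mem_flatMap.1 h'
    obtain ⟨h₁, rfl⟩ := key _ _ _ h
    obtain ⟨h₂, e⟩ := key _ _ _ h'
    exact (pair_eq_pair h₁ h₂ e).1

/-- The itemset of the edges of a graph. -/
noncomputable def Graph.edgeItemset (G : Graph) : Itemset where
  dom := G.size
  items := G.edgeItems
  nodup := G.nodup_edgeItems

theorem flatMap_range {α : Type*} (n : ℕ) (f : ℕ → List α) :
    (List.range n).flatMap f = (List.finRange n).flatMap fun i : Fin n => f i := by
  rw [← List.map_coe_finRange_eq_range, List.flatMap_map]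

/-- The items are enumerated in the order in which the machine reads the matrix, below the diagonal,
so the lists agree entry by entry. -/
theorem Graph.rows_edgeItemset (G : Graph) : G.edgeItemset.rows =
    List.replicate G.size true :: matrixEdges G.size G.rows G.size := by
  change List.replicate G.size true ::
    G.edgeItems.map (fun I => List.ofFn fun d : Fin G.size => decide (d ∈ I)) = _
  simp only [Graph.edgeItems, matrixEdges, rowEdges, flatMap_range, List.map_flatMap]
  refine congrArg _ (List.flatMap_congr fun i _ => List.flatMap_congr fun j _ => ?_)
  have h : (G.rows.getD i [])[(j : ℕ)]? = some (open Classical in decide (G.graph.Adj i j)) := by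
    simp [Graph.rows]
  have h' : (G.rows.getD i [])[(j : ℕ)]? = some true ↔ G.graph.Adj i j :=
    ⟨fun e => by simpa using h.symm.trans e, fun e => h.trans (by simp [e])⟩
  by_cases hij : j < i ∧ G.graph.Adj i j
  · rw [if_pos hij, if_pos ⟨hij.1, h'.2 hij.2⟩, List.map_singleton, ofFn_mem_pair hij.1]
  · rw [if_neg hij, if_neg fun e => hij ⟨e.1, h'.1 e.2⟩]
    rfl

/-- No order of `i` and `j` is assumed. For `i = j` both sides fail, as a singleton is not an edge.
-/
theorem Graph.pair_mem_edgeItems (G : Graph) (i j : Fin G.size) :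
    {i, j} ∈ G.edgeItems ↔ G.graph.Adj i j := by
  refine (G.mem_edgeItems _).trans ⟨?_, fun h => ?_⟩
  · rintro ⟨i', j', h, ha, e⟩
    rcases lt_trichotomy i j with hij | rfl | hij
    · obtain ⟨rfl, rfl⟩ := pair_eq_pair hij h e
      exact ha.symm
    · have h₁ := Finset.ext_iff.1 e i'
      have h₂ := Finset.ext_iff.1 e j'
      simp only [Finset.mem_insert, Finset.mem_singleton] at h₁ h₂
      grind
    · obtain ⟨rfl, rfl⟩ := pair_eq_pair hij h ((Finset.pair_comm j i).trans e)
      exact ha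
  · rcases lt_trichotomy i j with hij | rfl | hij
    · exact ⟨j, i, hij, h.symm, rfl⟩
    · exact absurd h (G.graph.irrefl)
    · exact ⟨i, j, hij, h, Finset.pair_comm _ _⟩

theorem Graph.mem_edgeItems_iff (G : Graph) (I : Finset (Fin G.size)) :
    I ∈ G.edgeItems ↔ ∃ i j, G.graph.Adj i j ∧ I = {i, j} := by
  constructor
  · intro h
    obtain ⟨i, j, _, ha, rfl⟩ := (G.mem_edgeItems _).1 h
    exact ⟨j, i, ha.symm, rfl⟩
  · rintro ⟨i, j, ha, rfl⟩
    exact (G.pair_mem_edgeItems i j).2 ha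

/-- The domain consists of all vertices, isolated ones included, so both kinds of isomorphism are
bijections of the same sets. Adjacency is membership of a pair, and taking images under `J` is
injective on sets. -/
theorem Graph.edgeItemset_isomorphic_iff (G H : Graph) :
    Nonempty (G.graph ≃g H.graph) ↔
      ItemsetIsomorphic G.edgeItemset.toFinset H.edgeItemset.toFinset := by
  change _ ↔ ∃ J : Fin G.size ≃ Fin H.size,
    G.edgeItems.toFinset.image (fun I => I.image J) = H.edgeItems.toFinset
  constructor
  · rintro ⟨φ⟩
    refine ⟨φ.toEquiv, ?_⟩
    ext I
    simp only [Finset.mem_image, List.mem_toFinset, Graph.mem_edgeItems_iff]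
    constructor
    · rintro ⟨_, ⟨i, j, ha, rfl⟩, rfl⟩
      exact ⟨φ i, φ j, φ.map_rel_iff.2 ha, by simp [Finset.image_insert]⟩
    · rintro ⟨i, j, ha, rfl⟩
      exact ⟨_, ⟨φ.symm i, φ.symm j, φ.symm.map_rel_iff.2 ha, rfl⟩, by
        simp [Finset.image_insert]⟩
  · rintro ⟨J, hJ⟩
    refine ⟨⟨J, fun {i j} => ?_⟩⟩
    rw [← H.pair_mem_edgeItems, ← G.pair_mem_edgeItems, ← List.mem_toFinset, ← List.mem_toFinset,
      ← hJ, ← (Finset.image_injective J.injective).mem_finset_image (s := G.edgeItems.toFinset)]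
    simp [Finset.image_insert]

/-! ### Size bounds and the reduction from GI to II -/

theorem length_encodeRows {n : ℕ} {R : List (List Bool)} (h : ∀ r ∈ R, r.length = n) :
    (encodeRows R).length = R.length * (n + 1) := by
  induction R with
  | nil => simp
  | cons r R ih =>
    rw [encodeRows_cons, List.length_append, List.length_cons, ih fun r hr => h r (by simp [hr]),
      List.length_map, h r (by simp), List.length_cons]
    ring

theorem length_flatMap_le {α β : Type*} (l : List α) (f : α → List β) (n : ℕ)
    (h : ∀ a ∈ l, (f a).length ≤ n) : (l.flatMap f).length ≤ l.length * n := by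
  induction l with
  | nil => simp
  | cons a l ih =>
    have h₁ := h a (by simp)
    have h₂ := ih fun a ha => h a (by simp [ha])
    rw [List.flatMap_cons, List.length_append, List.length_cons, Nat.succ_mul]
    lia

theorem Itemset.length_of_mem_rows (S : Itemset) : ∀ r ∈ S.rows, r.length = S.dom := by
  simp only [Itemset.rows, List.mem_cons, List.mem_map]
  rintro r (rfl | ⟨I, _, rfl⟩) <;> simp

theorem Graph.length_of_mem_rows (G : Graph) : ∀ r ∈ G.rows, r.length = G.size := by
  simp only [Graph.rows, List.mem_ofFn]
  rintro r ⟨I, _, rfl⟩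
  simp

theorem Graph.length_edgeItems_le (G : Graph) : G.edgeItems.length ≤ G.size * G.size := by
  refine (length_flatMap_le _ _ G.size fun i _ => ?_).trans_eq (by simp)
  refine (length_flatMap_le _ _ 1 fun j _ => ?_).trans_eq (by simp)
  split_ifs <;> simp

theorem gi_reducible_ii : PolyTimeReducible GI II := by
  refine ⟨Prod.map Graph.edgeItemset Graph.edgeItemset, ?_,
    fun x => Graph.edgeItemset_isomorphic_iff x.1 x.2⟩
  refine computableInPolyTime_pair (ea := fun G : Graph => encodeRows G.rows)
    (eb := fun S : Itemset => encodeRows S.rows) edgeProg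
    (.X * (.X * (2 * .X + 7) + .X + 3) + 3 * .X + 4) ((.X * .X + 1) * (.X + 1)) ?_ ?_
  · intro G o a b
    -- The input has length `n * (n + 1)`, so a polynomial bound in `n` is also one in the input
    -- length.
    have hs : G.size ≤ (encodeRows G.rows).length := by
      rw [length_encodeRows G.length_of_mem_rows]
      simp only [Graph.rows, List.length_ofFn]
      nlinarith
    rw [Graph.rows_edgeItemset]
    refine (runs_edgeProg [] o G.rows G.size a b (by simp [Graph.rows]) G.length_of_mem_rows).mono ?_
    simp only [Polynomial.eval_add, Polynomial.eval_mul, Polynomial.eval_X, Polynomial.eval_ofNat]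
    gcongr
  · intro G
    have hs : G.size ≤ (encodeRows G.rows).length := by
      rw [length_encodeRows G.length_of_mem_rows]
      simp only [Graph.rows, List.length_ofFn]
      nlinarith
    rw [length_encodeRows G.edgeItemset.length_of_mem_rows]
    simp only [Polynomial.eval_add, Polynomial.eval_mul, Polynomial.eval_X, Polynomial.eval_one]
    refine Nat.mul_le_mul ?_ (Nat.succ_le_succ hs)
    simp only [Itemset.rows, Graph.edgeItemset, List.length_cons, List.length_map]
    exact Nat.succ_le_succ (G.length_edgeItems_le.trans (Nat.mul_le_mul hs hs))

/-! ### The incidence graph of an itemset: the program -/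

/-- The number of commas in a string. -/
def commas (l : List Γ') : ℕ := (l.filter fun s => s = .comma).length

theorem commas_append (l l' : List Γ') : commas (l ++ l') = commas l + commas l' := by
  simp [commas]

theorem commas_map_bit (r : List Bool) : commas (r.map Γ'.bit) = 0 := by
  induction r with
  | nil => rfl
  | cons b r ih => simpa [commas] using ih

theorem commas_encodeRows (R : List (List Bool)) : commas (encodeRows R) = R.length := by
  induction R with
  | nil => rfl
  | cons r R ih =>
    rw [encodeRows_cons, commas_append, ← List.singleton_append, commas_append, ih,
      commas_map_bit]
    simp [commas]
    lia

/-- Push a blank if the symbol in the first register is a comma. -/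
def pushComma (k : Work) : Op A B :=
  .push (.w k) fun v => if v.r = some .comma then some .blank else none

/-- Push the bit in the first flag. -/
def pushF (k : Work) : Op A B := .push (.w k) fun v => some (.bit v.f)

attribute [simp] pushComma pushF

/-- Count the rows and the columns of a matrix. -/
def countMatrix : Prog A B :=
  .seq (.block [popR .x]) (.seq (.loop (fun v => isBit v.r)
    (.block [pushR .t, pushS .c₁ .blank, popR .x])) (.seq (.loop (fun v => v.r.isSome)
      (.block [pushR .t, pushComma .c₀, popR .x])) (move .t .x)))

/-- Columns are counted along the first row and rows by their commas, starting with the comma that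
ends the first row. What has been read is kept on `t` and restored. -/
theorem runs_countMatrix (i : List A) (o : List B) (a b : List Γ') (r : List Bool)
    (R : List (List Bool)) :
    Runs countMatrix ({}, ⟨i, o, { x := encodeRows (r :: R), a := a, b := b }⟩)
      (2 * (encodeRows (r :: R)).length + 3)
      ({}, ⟨i, o, { x := encodeRows (r :: R), a := a, b := b, c₀ := unary (R.length + 1)
                    c₁ := unary r.length }⟩) := by
  set x := Γ'.comma :: encodeRows R with hx
  have hx' : commas x = R.length + 1 := by
    rw [hx, ← List.singleton_append, commas_append, commas_encodeRows]
    simp [commas]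
    lia
  rw [encodeRows_cons, ← hx, ← hx']
  have h₁ := Runs.scan (A := A) (B := B) (c := fun v => isBit v.r)
    (p := .block [pushR .t, pushS .c₁ .blank, popR .x]) (n := 0)
    (fun pre suf => ({ r := (suf.map Γ'.bit ++ x).head? },
        ⟨i, o, { x := (suf.map Γ'.bit ++ x).tail
                 a := a, b := b, t := (pre.map Γ'.bit).reverse, c₁ := unary pre.length }⟩)) r
    rfl (fun _ _ _ _ => rfl) fun pre e suf hs => .block (by simp [unary_succ])
  have h₂ := Runs.scan (A := A) (B := B) (c := fun v => v.r.isSome)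
    (p := .block [pushR .t, pushComma .c₀, popR .x]) (n := 0)
    (fun pre suf => ({ r := suf.head? },
        ⟨i, o, { x := suf.tail, a := a, b := b, t := pre.reverse ++ (r.map Γ'.bit).reverse
                 c₀ := unary (commas pre), c₁ := unary r.length }⟩)) x
    rfl (fun _ _ _ _ => rfl) fun pre e suf hs => .block (by
      rw [commas_append]
      cases e <;> simp [commas, unary_succ])
  have h₃ := runs_move (A := A) (B := B) .t .x (by decide) {} i o
    { a := a, b := b, t := x.reverse ++ (r.map Γ'.bit).reverse
      c₀ := unary (commas x), c₁ := unary r.length }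
  refine (Runs.seq (.block rfl) (h₁.seq (.seq h₂ (h₃.cast ?_)))).mono ?_
  · simp
  · simp
    lia

/-- Write the row of the incidence graph that belongs to a row of the matrix. -/
def itemLine : Prog A B :=
  .seq (zeros .c₀) (.seq (.loop (fun v => isBit v.r) (.block [pushR .t, pushR .y, popR .x]))
    (.block [pushR .t, pushF .y, pushF .y, pushS .y .comma,
      .load fun v => { v with f := false }, popR .x]))

/-- A row of the matrix lists the adjacencies of an item to the elements; it is preceded by zeros
for the root and the items. The flag `f` gives the adjacency to the two extra vertices. It is set
for the header row only, which thereby becomes the row of the root. -/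
theorem runs_itemLine (i : List A) (o : List B) (x y a b t c₀ c₁ : List Γ') (f : Bool)
    (r : List Bool) :
    Runs itemLine ({ r := (r.map Γ'.bit ++ Γ'.comma :: x).head?, f := f, g := true },
        ⟨i, o, { x := (r.map Γ'.bit ++ Γ'.comma :: x).tail, y := y, a := a, b := b, t := t
                 c₀ := c₀, c₁ := c₁ }⟩)
      (2 * c₀.length + r.length + 3)
      ({ r := x.head?, g := true },
        ⟨i, o, { x := x.tail
                 y := (encodeRows [List.replicate c₀.length false ++ r ++ [f, f]]).reverse ++ y
                 a := a, b := b, t := (encodeRows [r]).reverse ++ t, c₀ := c₀, c₁ := c₁ }⟩) := by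
  have h₁ := runs_zeros (A := A) (B := B) .c₀ (by decide) (by decide)
    { r := (r.map Γ'.bit ++ Γ'.comma :: x).head?, f := f, g := true } i o
    { x := (r.map Γ'.bit ++ Γ'.comma :: x).tail, y := y, a := a, b := b, t := t
      c₀ := c₀, c₁ := c₁ } rfl
  have h₂ := Runs.scan (A := A) (B := B) (c := fun v => isBit v.r)
    (p := .block [pushR .t, pushR .y, popR .x]) (n := 0)
    (fun pre suf => ({ r := (suf.map Γ'.bit ++ Γ'.comma :: x).head?, f := f, g := true },
        ⟨i, o, { x := (suf.map Γ'.bit ++ Γ'.comma :: x).tail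
                 y := (pre.map Γ'.bit).reverse ++
                  (List.replicate c₀.length (.bit false) ++ y)
                 a := a, b := b, t := (pre.map Γ'.bit).reverse ++ t, c₀ := c₀, c₁ := c₁ }⟩)) r
    rfl (fun _ _ _ _ => rfl) fun pre e suf hs => .block (by simp)
  refine (Runs.seq h₁ (.seq h₂ (.block ?_))).mono ?_
  · simp [encodeRows]
  · simp
    lia

/-- The rows of the incidence graph that belong to the rows of the matrix. -/
def itemLines (R : List (List Bool)) (m : ℕ) : List (List Bool) :=
  R.mapIdx fun k r => List.replicate m false ++ r ++ [decide (k = 0), decide (k = 0)]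

/-- Write the rows of the incidence graph that belong to the rows of the matrix. -/
def itemPass : Prog A B :=
  .seq (.block [.load fun v => { v with f := true, g := true }, popR .x])
    (.seq (.loop (fun v => v.r.isSome) itemLine) (.seq (.block [.load fun _ => {}]) (move .t .x)))

theorem runs_itemPass (i : List A) (o : List B) (a b c₁ : List Γ') (R : List (List Bool))
    (m n : ℕ) (hn : ∀ r ∈ R, r.length = n) :
    Runs itemPass ({}, ⟨i, o, { x := encodeRows R, a := a, b := b, c₀ := unary m, c₁ := c₁ }⟩)
      (R.length * (2 * m + n + 4) + (encodeRows R).length + 2)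
      ({}, ⟨i, o, { x := encodeRows R, y := (encodeRows (itemLines R m)).reverse
                    a := a, b := b, c₀ := unary m, c₁ := c₁ }⟩) := by
  have h₁ := Runs.scan (A := A) (B := B) (c := fun v => v.r.isSome)
    (p := itemLine) (n := 2 * m + n + 3)
    (fun pre suf => ({ r := (encodeRows suf).head?, f := decide (pre.length = 0), g := true },
        ⟨i, o, { x := (encodeRows suf).tail, y := (encodeRows (itemLines pre m)).reverse
                 a := a, b := b, t := (encodeRows pre).reverse, c₀ := unary m, c₁ := c₁ }⟩)) R
    rfl (fun _ r suf _ => by cases r <;> simp [encodeRows_cons]) fun pre r suf hs => by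
    have := runs_itemLine i o (encodeRows suf) (encodeRows (itemLines pre m)).reverse a b
      (encodeRows pre).reverse (unary m) c₁ (decide (pre.length = 0)) r
    rw [← encodeRows_cons] at this
    refine (this.mono ?_).cast ?_
    · rw [length_unary, hn r (by simp [hs])]
    · simp [itemLines, List.mapIdx_concat, encodeRows_append]
  have h₂ := runs_move (A := A) (B := B) .t .x (by decide) {} i o
    { y := (encodeRows (itemLines R m)).reverse, a := a, b := b, t := (encodeRows R).reverse
      c₀ := unary m, c₁ := c₁ }
  refine (Runs.seq (.block ?_) (h₁.seq (.seq (.block rfl) (h₂.cast ?_)))).mono ?_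
  · simp [itemLines]
  · simp
  · simp
    lia

/-- Cut off the first column of a matrix, and write it. -/
def column : Prog A B :=
  .loop (fun v => v.r.isSome) (.seq (.block [pushR .y, popR .x])
    (.seq (.loop (fun v => isBit v.r) (.block [pushR .t, popR .x]))
      (.block [pushR .t, popR .x])))

/-- Giving each row as a pair of its first entry and the rest records that no row is empty. -/
theorem runs_column (v : Reg) (i : List A) (o : List B) (y a b c₀ c₁ : List Γ')
    (P : List (Bool × List Bool)) (n : ℕ) (hn : ∀ p ∈ P, p.2.length ≤ n) :
    Runs column ({ v with r := (encodeRows (P.map fun p => p.1 :: p.2)).head? },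
        ⟨i, o, { x := (encodeRows (P.map fun p => p.1 :: p.2)).tail, y := y, a := a, b := b
                 c₀ := c₀, c₁ := c₁ }⟩)
      (P.length * (n + 2) + 1)
      ({ v with r := none },
        ⟨i, o, { y := (P.map fun p => Γ'.bit p.1).reverse ++ y, a := a, b := b
                 t := (encodeRows (P.map Prod.snd)).reverse
                 c₀ := c₀, c₁ := c₁ }⟩) := by
  refine Runs.scan (A := A) (B := B) (c := fun v => v.r.isSome) (n := n + 1)
    (fun pre suf => ({ v with r := (encodeRows (suf.map fun p => p.1 :: p.2)).head? },
        ⟨i, o, { x := (encodeRows (suf.map fun p => p.1 :: p.2)).tail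
                 y := (pre.map fun p => Γ'.bit p.1).reverse ++ y, a := a, b := b
                 t := (encodeRows (pre.map Prod.snd)).reverse
                 c₀ := c₀, c₁ := c₁ }⟩)) P
    rfl (fun _ p suf _ => by simp [encodeRows_cons]) fun pre p suf hs => ?_
  have h₁ := Runs.scan (A := A) (B := B) (c := fun v => isBit v.r)
    (p := .block [pushR .t, popR .x]) (n := 0)
    (fun pre' suf' => ({ v with r := (suf'.map Γ'.bit ++
          Γ'.comma :: encodeRows (suf.map fun p => p.1 :: p.2)).head? },
        ⟨i, o, { x := (suf'.map Γ'.bit ++ Γ'.comma :: encodeRows (suf.map fun p => p.1 :: p.2)).tail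
                 y := ((pre ++ [p]).map fun p => Γ'.bit p.1).reverse ++ y, a := a, b := b
                 t := (pre'.map Γ'.bit).reverse ++ (encodeRows (pre.map Prod.snd)).reverse
                 c₀ := c₀, c₁ := c₁ }⟩)) p.2
    rfl (fun _ _ _ _ => rfl) fun pre' e suf' _ => .block (by simp)
  refine (Runs.seq (.block ?_) (h₁.seq (.block ?_))).mono ?_
  · simp [encodeRows_cons]
  · simp [encodeRows]
  · have := hn p (by simp [hs])
    lia

/-- The row of the incidence graph that belongs to a column of the matrix. -/
def elementLine (R : List (List Bool)) (n d : ℕ) : List Bool :=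
  R.map (fun r => r.getD d false) ++ List.replicate n false ++ [false, false]

/-- Write the rows of the incidence graph that belong to the columns of the matrix. -/
def elementPass : Prog A B :=
  .seq (.block [.load fun v => { v with g := true }, popR .x])
    (.seq (.loop (fun v => isBit v.r) (.seq column (.seq (zeros .c₁)
      (.seq (.block [pushS .y (.bit false), pushS .y (.bit false), pushS .y .comma])
        (.seq (move .t .x) (.block [popR .x]))))))
      (.seq (.block [.load fun v => { v with r := none }]) (clear .x)))

/-- Cutting off the first column again and again transposes the matrix. Since there is at least one
row, the first symbol tells whether columns remain: it is a comma once they are used up. The header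
contributes the adjacency of each element to the root. -/
theorem runs_elementPass (i : List A) (o : List B) (y a b c₀ : List Γ') (R : List (List Bool))
    (n : ℕ) (hR : R ≠ []) (hn : ∀ r ∈ R, r.length = n) :
    Runs elementPass ({}, ⟨i, o, { x := encodeRows R, y := y, a := a, b := b, c₀ := c₀
                                   c₁ := unary n }⟩)
      (n * (R.length * (n + 2) + 2 * n + (encodeRows R).length + 5) + (encodeRows R).length + 2)
      ({ g := true }, ⟨i, o, { y := (encodeRows ((List.range n).map (elementLine R n))).reverse ++ y
                               a := a, b := b, c₀ := c₀, c₁ := unary n }⟩) := by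
  -- Removing columns only shortens the string, so one time bound serves all rounds.
  have hlen (d : ℕ) : (encodeRows (R.map (List.drop d))).length ≤ (encodeRows R).length := by
    rw [length_encodeRows hn, length_encodeRows (n := n - d) (by
      intro r hr
      obtain ⟨r', hr', rfl⟩ := List.mem_map.1 hr
      simp [hn r' hr']), List.length_map]
    gcongr
    lia
  have h₁ := Runs.scan (A := A) (B := B) (c := fun v => isBit v.r)
    (p := .seq column (.seq (zeros .c₁)
      (.seq (.block [pushS .y (.bit false), pushS .y (.bit false), pushS .y .comma])
        (.seq (move .t .x) (.block [popR .x])))))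
    (n := R.length * (n + 2) + 2 * n + (encodeRows R).length + 4)
    (fun pre _ => ({ r := (encodeRows (R.map (List.drop pre.length))).head?, g := true },
        ⟨i, o, { x := (encodeRows (R.map (List.drop pre.length))).tail
                 y := (encodeRows ((List.range pre.length).map (elementLine R n))).reverse ++ y
                 a := a, b := b, c₀ := c₀, c₁ := unary n }⟩)) (List.range n)
    (by
      obtain ⟨r, R, rfl⟩ := List.exists_cons_of_ne_nil hR
      simp [encodeRows_cons, hn r])
    (fun pre d suf hs => by
      have hl := congrArg List.length hs
      rw [List.length_append, List.length_cons, List.length_range] at hl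
      obtain ⟨r, R, rfl⟩ := List.exists_cons_of_ne_nil hR
      have := hn r (by simp)
      rw [List.map_cons, List.drop_eq_getElem_cons (by lia), encodeRows_cons, List.map_cons]
      rfl)
    fun pre d suf hs => by
      have hl := congrArg List.length hs
      rw [List.length_append, List.length_cons, List.length_range] at hl
      set d := pre.length
      have e : R.map (List.drop d) =
          (R.map fun r => (r.getD d false, r.drop (d + 1))).map fun p => p.1 :: p.2 := by
        rw [List.map_map]
        refine List.map_congr_left fun r hr => ?_
        have := hn r hr
        rw [List.drop_eq_getElem_cons (by lia)]
        simp [List.getElem?_eq_getElem (show d < r.length by lia)]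
      set P := R.map fun r => (r.getD d false, r.drop (d + 1)) with hP
      have eP : P.map Prod.snd = R.map (List.drop (d + 1)) := by simp [hP]
      set Y := (encodeRows ((List.range d).map (elementLine R n))).reverse ++ y with hY
      set C := (P.map fun p => Γ'.bit p.1).reverse with hC
      have k₁ := runs_column { g := true } i o Y a b c₀ (unary n) P n (by
        simp only [hP, List.mem_map]
        rintro p ⟨r, hr, rfl⟩
        simp [hn r hr])
      have k₂ := runs_zeros (A := A) (B := B) .c₁ (by decide) (by decide) { g := true } i o
        { y := C ++ Y, a := a, b := b, t := (encodeRows (P.map Prod.snd)).reverse, c₀ := c₀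
          c₁ := unary n } rfl
      have k₃ := runs_move (A := A) (B := B) .t .x (by decide) { g := true } i o
        { y := Γ'.comma :: .bit false :: .bit false ::
            (List.replicate n (.bit false) ++ (C ++ Y))
          a := a, b := b, t := (encodeRows (P.map Prod.snd)).reverse, c₀ := c₀, c₁ := unary n }
      have hl' := hlen (d + 1)
      rw [← eP] at hl'
      rw [e]
      refine (k₁.seq (k₂.seq (.seq (.block ?_) (k₃.seq (.block ?_))))).mono ?_
      · simp
      · rw [List.length_append, List.length_singleton, List.range_succ, ← eP]
        simp [hY, hC, hP, encodeRows_append, encodeRows_cons, elementLine, Function.comp_def]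
        rfl
      · simp [hP] at hl' ⊢
        lia
  have h₂ := runs_clear (A := A) (B := B) .x { g := true } i o
    { x := (encodeRows (R.map (List.drop n))).tail
      y := (encodeRows ((List.range n).map (elementLine R n))).reverse ++ y
      a := a, b := b, c₀ := c₀, c₁ := unary n }
  have hl := hlen n
  rw [List.length_range] at h₁
  refine (Runs.seq (.block ?_) (h₁.seq (.seq (.block ?_) h₂))).mono ?_
  · simp [show (List.drop 0 : List Bool → List Bool) = id from rfl]
  · simp
  · simp
    lia

/-- Write the last two rows of the incidence graph. -/
def lastLines : Prog A B :=
  .seq (.block [popP .c₀, .load fun v => { v with p := none }, pushS .y (.bit true)])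
    (.seq (zeros .c₀) (.seq (zeros .c₁)
      (.seq (.block [pushS .y (.bit false), pushS .y (.bit true), pushS .y .comma,
        pushS .y (.bit true)]) (.seq (zeros .c₀) (.seq (zeros .c₁)
      (.seq (.block [pushS .y (.bit true), pushS .y (.bit false), pushS .y .comma])
        (.seq (clear .c₀) (.seq (clear .c₁) (.block [.load fun _ => {}])))))))))

/-- The last two rows of the incidence graph; the flag distinguishes them. -/
def lastLine (m n : ℕ) (f : Bool) : List Bool :=
  true :: List.replicate m false ++ List.replicate n false ++ [f, !f]

/-- The counter `c₀` includes the root; one blank is popped because the entry for the root is a one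
and only the `m` items get zeros. -/
theorem runs_lastLines (i : List A) (o : List B) (y a b : List Γ') (m n : ℕ) :
    Runs lastLines ({ g := true }, ⟨i, o, { y := y, a := a, b := b, c₀ := unary (m + 1)
                                            c₁ := unary n }⟩)
      (5 * (m + n) + 10)
      ({}, ⟨i, o, { y := (encodeRows [lastLine m n false, lastLine m n true]).reverse ++ y
                    a := a, b := b }⟩) := by
  set M : List Γ' → Tapes := fun y =>
    { y := y, a := a, b := b, c₀ := unary m, c₁ := unary n } with hM
  have h₁ (y : List Γ') : Runs (zeros .c₀) ({ g := true }, ⟨i, o, M y⟩) (2 * m + 2)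
      ({ g := true }, ⟨i, o, M (List.replicate m (.bit false) ++ y)⟩) := by
    simpa [hM] using runs_zeros .c₀ (by decide) (by decide) { g := true } i o (M y) rfl
  have h₂ (y : List Γ') : Runs (zeros .c₁) ({ g := true }, ⟨i, o, M y⟩) (2 * n + 2)
      ({ g := true }, ⟨i, o, M (List.replicate n (.bit false) ++ y)⟩) := by
    simpa [hM] using runs_zeros .c₁ (by decide) (by decide) { g := true } i o (M y) rfl
  have h₃ (y : List Γ') := runs_clear (A := A) (B := B) .c₀ { g := true } i o (M y)
  have h₄ (y : List Γ') := runs_clear (A := A) (B := B) .c₁ { g := true } i o ((M y).set .c₀ [])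
  refine (Runs.seq (s' := ({ g := true }, ⟨i, o, M (Γ'.bit true :: y)⟩)) (.block ?_)
    ((h₁ _).seq ((h₂ _).seq (.seq (.block rfl) ((h₁ _).seq ((h₂ _).seq (.seq (.block rfl)
      ((h₃ _).seq ((h₄ _).seq (.block ?_)))))))))).mono ?_
  · simp [hM]
  · simp [hM, encodeRows, lastLine]
    simp only [Nat.add_comm m n, List.replicate_add, List.append_assoc]
  · simp [hM]
    lia

/-- From the matrix of an itemset to the adjacency matrix of its incidence graph. -/
def incidenceProg : Prog A B :=
  .seq countMatrix (.seq itemPass (.seq elementPass lastLines))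

/-- The adjacency matrix of the incidence graph of an itemset. -/
def incidenceRows (R : List (List Bool)) (m n : ℕ) : List (List Bool) :=
  itemLines R (m + 1) ++ (List.range n).map (elementLine R n) ++
    [lastLine m n false, lastLine m n true]

theorem runs_incidenceProg (i : List A) (o : List B) (R : List (List Bool)) (m n : ℕ)
    (a b : List Γ') (hR : R.length = m + 1) (hR' : ∀ r ∈ R, r.length = n) (N : ℕ)
    (hN : (encodeRows R).length = N) :
    Runs incidenceProg ({}, ⟨i, o, { x := encodeRows R, a := a, b := b }⟩)
      ((2 * N + 3) + ((m + 1) * (2 * (m + 1) + n + 4) + N + 2) +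
        (n * ((m + 1) * (n + 2) + 2 * n + N + 5) + N + 2) + (5 * (m + n) + 10))
      ({}, ⟨i, o, { y := (encodeRows (incidenceRows R m n)).reverse, a := a, b := b }⟩) := by
  have h₁ := runs_countMatrix i o a b (R.headD []) R.tail
  have h₂ := runs_itemPass i o a b (unary n) R (m + 1) n hR'
  have hne : R ≠ [] := by
    rintro rfl
    simp at hR
  have h₃ := runs_elementPass i o (encodeRows (itemLines R (m + 1))).reverse a b (unary (m + 1)) R
    n hne hR'
  have h₄ := runs_lastLines i o ((encodeRows ((List.range n).map (elementLine R n))).reverse ++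
    (encodeRows (itemLines R (m + 1))).reverse) a b m n
  obtain ⟨r, R, rfl⟩ := List.exists_cons_of_ne_nil hne
  rw [List.headD_cons, List.tail_cons, hR' r (by simp), ← List.length_cons, hR] at h₁
  refine ((h₁.seq (h₂.seq (h₃.seq h₄))).cast ?_).mono ?_
  · simp [incidenceRows, encodeRows_append]
  · rw [hN, hR]
    lia

/-! ### The incidence graph of an itemset: correctness -/

section IncidenceGraph

variable {D E : Type}

/-- The vertices of the incidence graph: a root (`none`), the items, the elements of the domain,
and two more vertices. -/
abbrev IncidenceVertex (S : Finset (Finset D)) : Type := (Option S ⊕ D) ⊕ Bool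

/-- Adjacency in the incidence graph: the elements of the domain are adjacent to the items that
contain them and to the root; the root and the two extra vertices form a triangle. -/
def IncidenceAdj (S : Finset (Finset D)) : IncidenceVertex S → IncidenceVertex S → Prop
  | .inl (.inl none), .inl (.inr _) => True
  | .inl (.inl (some I)), .inl (.inr d) => d ∈ I.1
  | .inl (.inr _), .inl (.inl none) => True
  | .inl (.inr d), .inl (.inl (some I)) => d ∈ I.1
  | .inl (.inl none), .inr _ => True
  | .inr _, .inl (.inl none) => True
  | .inr b, .inr b' => b ≠ b'
  | _, _ => False

/-- The incidence graph of an itemset, with a triangle attached to mark the kinds of vertices. -/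
def incidenceGraph (S : Finset (Finset D)) : SimpleGraph (IncidenceVertex S) where
  Adj := IncidenceAdj S
  symm := ⟨by
    rintro (((_ | I) | d) | b) (((_ | I') | d') | b') <;> simp [IncidenceAdj]
    exact fun h => Ne.symm h⟩
  loopless := ⟨by rintro (((_ | I) | d) | b) <;> simp [IncidenceAdj]⟩

/-- The vertex lies in a triangle. -/
def InTriangle {V : Type*} (G : SimpleGraph V) (v : V) : Prop :=
  ∃ u w, G.Adj v u ∧ G.Adj v w ∧ G.Adj u w

theorem inTriangle_iso {V W : Type*} {G : SimpleGraph V} {H : SimpleGraph W} (φ : G ≃g H) (v : V) :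
    InTriangle H (φ v) ↔ InTriangle G v := by
  simp only [InTriangle, φ.surjective.exists, φ.map_adj_iff]

variable {S : Finset (Finset D)} {T : Finset (Finset E)}

/-- All neighbours of an item are elements, and elements are pairwise non-adjacent. -/
theorem not_inTriangle_item (I : S) : ¬ InTriangle (incidenceGraph S) (.inl (.inl (some I))) := by
  rintro ⟨((_ | I) | d) | b, ((_ | I') | d') | b', h₁, h₂, h₃⟩ <;>
    simp_all [incidenceGraph, IncidenceAdj]

/-- The neighbours of an element are the root and items, which are pairwise non-adjacent. -/
theorem not_inTriangle_elem (d : D) : ¬ InTriangle (incidenceGraph S) (.inl (.inr d)) := by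
  rintro ⟨((_ | I) | d) | b, ((_ | I') | d') | b', h₁, h₂, h₃⟩ <;>
    simp_all [incidenceGraph, IncidenceAdj]

theorem inTriangle_root : InTriangle (incidenceGraph S) (.inl (.inl none)) :=
  ⟨.inr false, .inr true, trivial, trivial, Bool.false_ne_true⟩

theorem inTriangle_extra (b : Bool) : InTriangle (incidenceGraph S) (.inr b) :=
  ⟨.inl (.inl none), .inr !b, trivial, by cases b <;> simp [incidenceGraph, IncidenceAdj], trivial⟩

/-- An element lies in no triangle but has a neighbour, the root, that does; items have only
elements as neighbours and so lack this property, which isomorphisms preserve. -/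
theorem exists_map_elem (φ : incidenceGraph S ≃g incidenceGraph T) (d : D) :
    ∃ e, φ (.inl (.inr d)) = .inl (.inr e) := by
  have h₁ : ¬ InTriangle _ (φ (.inl (.inr d))) := (inTriangle_iso φ _).not.2 (not_inTriangle_elem d)
  have h₂ : InTriangle _ (φ (.inl (.inl none))) := (inTriangle_iso φ _).2 inTriangle_root
  have h₃ : (incidenceGraph T).Adj (φ (.inl (.inr d))) (φ (.inl (.inl none))) :=
    φ.map_adj_iff.2 trivial
  generalize φ (.inl (.inr d)) = v at *
  generalize φ (.inl (.inl none)) = w at *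
  rcases v with ((_ | I) | e) | b
  · exact absurd inTriangle_root h₁
  · rcases w with ((_ | I') | e) | b
    · exact h₃.elim
    · exact h₃.elim
    · exact absurd h₂ (not_inTriangle_elem e)
    · exact h₃.elim
  · exact ⟨e, rfl⟩
  · exact absurd (inTriangle_extra b) h₁

/-- The image lies in no triangle, and it is not an element since the inverse maps elements to
elements. This also covers the empty item, which is an isolated vertex. -/
theorem exists_map_item (φ : incidenceGraph S ≃g incidenceGraph T) (I : S) :
    ∃ K, φ (.inl (.inl (some I))) = .inl (.inl (some K)) := by
  have h₁ : ¬ InTriangle _ (φ (.inl (.inl (some I)))) :=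
    (inTriangle_iso φ _).not.2 (not_inTriangle_item I)
  generalize h : φ (.inl (.inl (some I))) = v at *
  rcases v with ((_ | I) | e) | b
  · exact absurd inTriangle_root h₁
  · exact ⟨_, rfl⟩
  · obtain ⟨d, hd⟩ := exists_map_elem φ.symm e
    rw [← h] at hd
    simp at hd
  · exact absurd (inTriangle_extra b) h₁

/-- Only the action on items and elements matters. The root need not be fixed: over an empty domain
it can be exchanged with an extra vertex. -/
theorem incidenceGraph_iso_iff [DecidableEq D] [DecidableEq E] :
    ItemsetIsomorphic S T ↔ Nonempty (incidenceGraph S ≃g incidenceGraph T) := by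
  constructor
  · rintro ⟨J, hJ⟩
    have hJ' (I : Finset D) : I ∈ S ↔ J.finsetCongr I ∈ T := by
      rw [← hJ, Equiv.finsetCongr_apply, Finset.map_eq_image]
      exact ((Finset.image_injective J.injective).mem_finset_image (s := S)).symm
    let σ : S ≃ T := J.finsetCongr.subtypeEquiv hJ'
    have hσ (I : S) (d : D) : J d ∈ (σ I).1 ↔ d ∈ I.1 := by
      simp [σ, Equiv.finsetCongr_apply]
    refine ⟨⟨Equiv.sumCongr (Equiv.sumCongr σ.optionCongr J) (Equiv.refl _), ?_⟩⟩
    rintro (((_ | I) | d) | b) (((_ | I') | d') | b') <;>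
      simp [incidenceGraph, IncidenceAdj, hσ]
  · rintro ⟨φ⟩
    choose J hJ using exists_map_elem φ
    choose J' hJ' using exists_map_elem φ.symm
    have hl (d : D) : J' (J d) = d := by
      have := hJ' (J d)
      rw [← hJ, φ.symm_apply_apply] at this
      simpa using this.symm
    have hr (e : E) : J (J' e) = e := by
      have := hJ (J' e)
      rw [← hJ', φ.apply_symm_apply] at this
      simpa using this.symm
    -- Membership of an element in an item is adjacency, so `J` carries each item to the item
    -- assigned to it by `φ`.
    have key (I : S) (K : T) (h : φ (.inl (.inl (some I))) = .inl (.inl (some K))) :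
        I.1.image J = K.1 := by
      have hm (d : D) : J d ∈ K.1 ↔ d ∈ I.1 := by
        have : (incidenceGraph T).Adj (φ (.inl (.inl (some I)))) (φ (.inl (.inr d))) ↔
          (incidenceGraph S).Adj (.inl (.inl (some I))) (.inl (.inr d)) := φ.map_adj_iff
        rwa [h, hJ] at this
      ext e
      rw [← hr e, hm, Finset.mem_image]
      refine ⟨fun ⟨d, hd, h⟩ => ?_, fun h => ⟨_, h, rfl⟩⟩
      rw [← hl d, h, hl] at hd
      exact hd
    refine ⟨⟨J, J', hl, hr⟩, ?_⟩
    ext K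
    rw [Finset.mem_image]
    constructor
    · rintro ⟨I, hI, rfl⟩
      obtain ⟨K, hK⟩ := exists_map_item φ ⟨I, hI⟩
      have := key _ _ hK
      exact this ▸ K.2
    · intro hK
      obtain ⟨I, hI⟩ := exists_map_item φ.symm ⟨K, hK⟩
      refine ⟨I.1, I.2, key I ⟨K, hK⟩ ?_⟩
      rw [← hI, φ.apply_symm_apply]

end IncidenceGraph

/-! ### The adjacency matrix of the incidence graph, in blocks -/

theorem ofFn_castAdd_append {α : Type*} {m n : ℕ} (f : Fin (m + n) → α) :
    List.ofFn f = List.ofFn (fun i => f (Fin.castAdd n i)) ++ List.ofFn fun i => f (Fin.natAdd m i) :=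
  List.ofFn_add

/-- The numbering of the items. -/
noncomputable def Itemset.itemEquiv (S : Itemset) : Fin S.items.length ≃ S.toFinset :=
  (S.nodup.getEquiv).trans (Equiv.subtypeEquivRight fun _ => List.mem_toFinset.symm)

/-- The numbering of the vertices of the incidence graph. -/
noncomputable def Itemset.vertexEquiv (S : Itemset) :
    Fin (S.items.length + 1 + S.dom + 2) ≃ IncidenceVertex S.toFinset :=
  finSumFinEquiv.symm.trans (Equiv.sumCongr
    (finSumFinEquiv.symm.trans (Equiv.sumCongr
      ((finSuccEquiv _).trans S.itemEquiv.optionCongr) (Equiv.refl _))) finTwoEquiv)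

variable (S : Itemset)

theorem Itemset.vertexEquiv_root :
    S.vertexEquiv (Fin.castAdd 2 (Fin.castAdd S.dom 0)) = .inl (.inl none) := by
  simp [Itemset.vertexEquiv]

theorem Itemset.vertexEquiv_item (k : Fin S.items.length) :
    S.vertexEquiv (Fin.castAdd 2 (Fin.castAdd S.dom k.succ)) =
      .inl (.inl (some (S.itemEquiv k))) := by
  simp [Itemset.vertexEquiv]

theorem Itemset.vertexEquiv_elem (d : Fin S.dom) :
    S.vertexEquiv (Fin.castAdd 2 (Fin.natAdd (S.items.length + 1) d)) = .inl (.inr d) := by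
  simp [Itemset.vertexEquiv]

theorem Itemset.vertexEquiv_extra (b : Fin 2) :
    S.vertexEquiv (Fin.natAdd (S.items.length + 1 + S.dom) b) = .inr (finTwoEquiv b) := by
  simp [Itemset.vertexEquiv]

/-- The incidence graph of an itemset, with its vertices numbered. -/
noncomputable def Itemset.incidence : Graph where
  size := S.items.length + 1 + S.dom + 2
  graph := (incidenceGraph S.toFinset).comap S.vertexEquiv

theorem Itemset.isomorphic_iff_incidence (S T : Itemset) :
    ItemsetIsomorphic S.toFinset T.toFinset ↔
      Nonempty (S.incidence.graph ≃g T.incidence.graph) := by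
  rw [incidenceGraph_iso_iff]
  have φ := SimpleGraph.Iso.comap S.vertexEquiv (incidenceGraph S.toFinset)
  have ψ := SimpleGraph.Iso.comap T.vertexEquiv (incidenceGraph T.toFinset)
  exact ⟨fun ⟨f⟩ => ⟨(φ.trans f).trans ψ.symm⟩, fun ⟨f⟩ => ⟨(φ.symm.trans f).trans ψ⟩⟩

/-- The vertex, without the proof that an item belongs to the itemset. -/
def IncidenceVertex.raw {D : Type} {S : Finset (Finset D)} :
    IncidenceVertex S → (Option (Finset D) ⊕ D) ⊕ Bool :=
  Sum.map (Sum.map (Option.map Subtype.val) id) id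

/-- Adjacency in the incidence graph, as a Boolean. -/
def rawAdj {D : Type} [DecidableEq D] : (Option (Finset D) ⊕ D) ⊕ Bool →
    (Option (Finset D) ⊕ D) ⊕ Bool → Bool
  | .inl (.inl none), .inl (.inr _) => true
  | .inl (.inl (some I)), .inl (.inr d) => decide (d ∈ I)
  | .inl (.inr _), .inl (.inl none) => true
  | .inl (.inr d), .inl (.inl (some I)) => decide (d ∈ I)
  | .inl (.inl none), .inr _ => true
  | .inr _, .inl (.inl none) => true
  | .inr b, .inr b' => xor b b'
  | _, _ => false

/-- Dropping the membership proofs lets the rows be computed directly from the list of items. The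
decidability instance is arbitrary, to match the classical one in `Graph.rows`. -/
theorem decide_incidenceAdj {D : Type} [DecidableEq D] {S : Finset (Finset D)}
    (v w : IncidenceVertex S) (h : Decidable (IncidenceAdj S v w)) :
    decide (IncidenceAdj S v w) = rawAdj v.raw w.raw := by
  rw [Bool.eq_iff_iff, decide_eq_true_iff]
  rcases v with (((_ | I) | d) | b) <;> rcases w with (((_ | I') | d') | b') <;>
    simp [IncidenceAdj, rawAdj, IncidenceVertex.raw]

/-- A row of the adjacency matrix of the incidence graph. -/
def Itemset.incidenceRow (v : (Option (Finset (Fin S.dom)) ⊕ Fin S.dom) ⊕ Bool) : List Bool :=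
  (rawAdj v (.inl (.inl none)) :: S.items.map fun I => rawAdj v (.inl (.inl (some I)))) ++
  (List.ofFn fun d => rawAdj v (.inl (.inr d))) ++
  [rawAdj v (.inr false), rawAdj v (.inr true)]

theorem Itemset.ofFn_rawAdj (v : (Option (Finset (Fin S.dom)) ⊕ Fin S.dom) ⊕ Bool) :
    (List.ofFn fun j => rawAdj v (S.vertexEquiv j).raw) = S.incidenceRow v := by
  rw [ofFn_castAdd_append, ofFn_castAdd_append, List.ofFn_succ, Itemset.incidenceRow]
  simp only [vertexEquiv_root, vertexEquiv_item, vertexEquiv_elem, vertexEquiv_extra]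
  rw [← List.ofFn_getElem_eq_map]
  rfl

theorem Itemset.rows_incidence_eq : S.incidence.rows =
    (S.incidenceRow (.inl (.inl none)) :: S.items.map fun I =>
      S.incidenceRow (.inl (.inl (some I)))) ++
    (List.ofFn fun d => S.incidenceRow (.inl (.inr d))) ++
    [S.incidenceRow (.inr false), S.incidenceRow (.inr true)] := by
  have h : S.incidence.rows = List.ofFn fun i => S.incidenceRow (S.vertexEquiv i).raw := by
    simp only [← Itemset.ofFn_rawAdj, ← decide_incidenceAdj _ _ (Classical.propDecidable _)]
    rfl
  rw [h, ofFn_castAdd_append, ofFn_castAdd_append, List.ofFn_succ]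
  simp only [vertexEquiv_root, vertexEquiv_item, vertexEquiv_elem, vertexEquiv_extra]
  rw [← List.ofFn_getElem_eq_map]
  rfl

theorem Itemset.incidenceRow_root : S.incidenceRow (.inl (.inl none)) =
    List.replicate (S.items.length + 1) false ++ List.replicate S.dom true ++ [true, true] := by
  simp [Itemset.incidenceRow, rawAdj, List.replicate_succ, List.ofFn_const]

theorem Itemset.incidenceRow_item (I : Finset (Fin S.dom)) :
    S.incidenceRow (.inl (.inl (some I))) =
    List.replicate (S.items.length + 1) false ++ (List.ofFn fun d => decide (d ∈ I)) ++
      [false, false] := by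
  simp [Itemset.incidenceRow, rawAdj, List.replicate_succ]

theorem Itemset.incidenceRow_elem (d : Fin S.dom) : S.incidenceRow (.inl (.inr d)) =
    elementLine S.rows S.dom d := by
  simp [Itemset.incidenceRow, rawAdj, elementLine, Itemset.rows, Function.comp_def]

theorem Itemset.incidenceRow_extra (b : Bool) : S.incidenceRow (.inr b) =
    lastLine S.items.length S.dom b := by
  cases b <;> simp [Itemset.incidenceRow, rawAdj, lastLine]

/-- The blocks of the vertex numbering (root, items, elements, extra vertices) are the blocks that
the machine writes, with the root at the header row. -/
theorem Itemset.rows_incidence :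
    S.incidence.rows = incidenceRows S.rows S.items.length S.dom := by
  have h : List.map (elementLine S.rows S.dom) (List.range S.dom) =
      List.ofFn fun d : Fin S.dom => elementLine S.rows S.dom d := by
    rw [← List.map_coe_finRange_eq_range, List.map_map, List.ofFn_eq_map]
    rfl
  simp only [S.rows_incidence_eq, incidenceRow_root, incidenceRow_item, incidenceRow_elem,
    incidenceRow_extra, incidenceRows, itemLines, h]
  congr 2
  simp only [Itemset.rows, List.mapIdx_cons]
  congr 1
  exact List.ext_getElem (by simp) fun k h₁ h₂ => by simp

theorem Itemset.length_encodeRows_rows :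
    (encodeRows S.rows).length = (S.items.length + 1) * (S.dom + 1) := by
  rw [length_encodeRows S.length_of_mem_rows]
  simp [Itemset.rows]

theorem Itemset.length_items_le : S.items.length ≤ (encodeRows S.rows).length := by
  rw [S.length_encodeRows_rows]
  nlinarith

theorem Itemset.dom_le : S.dom ≤ (encodeRows S.rows).length := by
  rw [S.length_encodeRows_rows]
  nlinarith

theorem ii_reducible_gi : PolyTimeReducible II GI := by
  refine ⟨Prod.map Itemset.incidence Itemset.incidence, ?_,
    fun x => Itemset.isomorphic_iff_incidence x.1 x.2⟩
  refine computableInPolyTime_pair (ea := fun S : Itemset => encodeRows S.rows)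
    (eb := fun G : Graph => encodeRows G.rows) incidenceProg
    ((2 * .X + 3) + ((.X + 1) * (2 * (.X + 1) + .X + 4) + .X + 2) +
        (.X * ((.X + 1) * (.X + 2) + 2 * .X + .X + 5) + .X + 2) + (5 * (.X + .X) + 10))
      ((.X + 1 + .X + 2) * ((.X + 1 + .X + 2) + 1)) ?_ ?_
  · intro S o a b
    have hm : S.items.length ≤ (encodeRows S.rows).length := S.length_items_le
    have hn : S.dom ≤ (encodeRows S.rows).length := S.dom_le
    rw [Itemset.rows_incidence]
    refine (runs_incidenceProg [] o S.rows S.items.length S.dom a b (by simp [Itemset.rows])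
      S.length_of_mem_rows _ rfl).mono ?_
    simp only [Polynomial.eval_add, Polynomial.eval_mul, Polynomial.eval_X, Polynomial.eval_ofNat,
      Polynomial.eval_one]
    gcongr
  · intro S
    have hm : S.items.length ≤ (encodeRows S.rows).length := S.length_items_le
    have hn : S.dom ≤ (encodeRows S.rows).length := S.dom_le
    rw [length_encodeRows S.incidence.length_of_mem_rows]
    simp only [Polynomial.eval_add, Polynomial.eval_mul, Polynomial.eval_X, Polynomial.eval_ofNat,
      Polynomial.eval_one, Graph.rows, List.length_ofFn, Itemset.incidence]
    gcongr

/-! ### Rearranging a matrix, guided by a string of bits: the program -/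

/-- A matrix, whose columns are to be moved to the rows of another matrix, and a flag that tells
whether the matrix has been transposed. -/
@[ext] structure Sheet where
  rest : List (List Bool)
  done : List (List Bool)
  flipped : Bool
  deriving DecidableEq

/-- Move the first column to the other matrix, if the bit is set; otherwise make it the last
column. If there are no columns, then continue with the other matrix. -/
def Sheet.step (s : Sheet) (b : Bool) : Sheet :=
  if s.rest.headD [] = [] then ⟨s.done, [], !s.flipped⟩
  else if b then ⟨s.rest.map List.tail, s.done ++ [s.rest.map fun r => r.headD false], s.flipped⟩
  else ⟨s.rest.map fun r => r.rotate 1, s.done, s.flipped⟩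

/-- Make the first column of a matrix the last one. -/
def rotateColumns : Prog A B :=
  .loop (fun v => v.q.isSome) (.seq (.block [popR .x])
    (.seq (.loop (fun v => isBit v.r) (.block [pushR .t, popR .x]))
      (.block [pushQ .t, pushR .t, .load fun v => { v with r := none }, popQ .x])))

/-- The first bit of a row waits in the register `q` while the others go to `t`, and is put behind
them. -/
theorem runs_rotateColumns (v : Reg) (hv : v.r = none) (i : List A) (o : List B)
    (y c₀ c₁ : List Γ') (P : List (Bool × List Bool)) (n : ℕ) (hn : ∀ p ∈ P, p.2.length ≤ n) :
    Runs rotateColumns ({ v with q := (encodeRows (P.map fun p => p.1 :: p.2)).head? },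
        ⟨i, o, { x := (encodeRows (P.map fun p => p.1 :: p.2)).tail, y := y
                 c₀ := c₀, c₁ := c₁ }⟩)
      (P.length * (n + 2) + 1)
      ({ v with q := none }, ⟨i, o, { y := y
                                      t := (encodeRows (P.map fun p => p.2 ++ [p.1])).reverse
                                      c₀ := c₀, c₁ := c₁ }⟩) := by
  refine Runs.scan (A := A) (B := B) (c := fun v => v.q.isSome) (n := n + 1)
    (fun pre suf => ({ v with q := (encodeRows (suf.map fun p => p.1 :: p.2)).head? },
        ⟨i, o, { x := (encodeRows (suf.map fun p => p.1 :: p.2)).tail, y := y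
                 t := (encodeRows (pre.map fun p => p.2 ++ [p.1])).reverse
                 c₀ := c₀, c₁ := c₁ }⟩)) P
    rfl (fun _ p suf _ => by simp [encodeRows_cons]) fun pre p suf hs => ?_
  have h₁ := Runs.scan (A := A) (B := B) (c := fun v => isBit v.r)
    (p := .block [pushR .t, popR .x]) (n := 0)
    (fun pre' suf' => ({ v with
          r := (suf'.map Γ'.bit ++ Γ'.comma :: encodeRows (suf.map fun p => p.1 :: p.2)).head?
          q := some (.bit p.1) },
        ⟨i, o, { x := (suf'.map Γ'.bit ++ Γ'.comma :: encodeRows (suf.map fun p => p.1 :: p.2)).tail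
                 y := y
                 t := (pre'.map Γ'.bit).reverse ++
                  (encodeRows (pre.map fun p => p.2 ++ [p.1])).reverse
                 c₀ := c₀, c₁ := c₁ }⟩)) p.2
    rfl (fun _ _ _ _ => rfl) fun pre' e suf' _ => .block (by simp)
  refine (Runs.seq (.block ?_) (h₁.seq (.block ?_))).mono ?_
  · simp [encodeRows_cons]
  · simp [encodeRows, hv]
  · have := hn p (by simp [hs])
    lia

/-- Replace a matrix by the other one. -/
def exchange : Prog A B :=
  .loop (fun v => v.tag = 1) (.seq (clear .x) (.seq (move .y .x)
    (.block [.load fun v => { v with tag := 0, g := !v.g }])))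

/-- Choose between moving the first column, rotating the columns, and exchanging the matrices. -/
def chooseMode (v : Reg) : Reg :=
  if isBit v.r then (if v.q = some (.bit true) then { v with q := none, f := true }
    else { v with q := v.r, r := none })
  else { v with r := none, q := none, tag := 1 }

/-- Push a comma if the first flag is set. -/
def pushRowEnd : Op A B := .push (.w .y) fun v => if v.f then some .comma else none

attribute [simp] pushRowEnd

/-- One step of the rearrangement. -/
def sheetStep : Prog A B :=
  .seq (.block [popR .x, .load chooseMode]) (.seq column
    (.seq (.block [pushRowEnd, .load fun v => { v with f := false }]) (.seq rotateColumns (.seq exchange (.seq (move .t .x) (.block [popQ .c₁]))))))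

theorem exists_columns {X : List (List Bool)} {n : ℕ} (hX : ∀ r ∈ X, r.length = n + 1) :
    X = (X.map fun r => (r.headD false, r.tail)).map fun p => p.1 :: p.2 := by
  rw [List.map_map, List.map_congr_left (g := id), List.map_id]
  intro r hr
  cases r with
  | nil => simpa using hX _ hr
  | cons b r => rfl

/-- The language has no conditionals: the programs for all three moves are run in sequence, and
those not selected by `chooseMode` stop at their first loop test. -/
theorem runs_sheetStep (i : List A) (o : List B) (s : Sheet) (b : Bool) (c₀ c₁ : List Γ')
    (n N : ℕ) (hX : ∀ r ∈ s.rest, r.length = n) (hN : (encodeRows s.rest).length ≤ N)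
    (hN' : (encodeRows s.done).length ≤ N) :
    Runs sheetStep ({ q := some (.bit b), g := s.flipped },
        ⟨i, o, { x := encodeRows s.rest, y := (encodeRows s.done).reverse, c₀ := c₀, c₁ := c₁ }⟩)
      (4 * N + 8)
      ({ q := c₁.head?, g := (s.step b).flipped },
        ⟨i, o, { x := encodeRows (s.step b).rest, y := (encodeRows (s.step b).done).reverse
                 c₀ := c₀, c₁ := c₁.tail }⟩) := by
  have idCol (v : Reg) (hv : v.r = none) (m : Mem A B) : Runs (column : Prog A B) (v, m) 1 (v, m) :=
    .done (by simp [hv])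
  have idRot (v : Reg) (hv : v.q = none) (m : Mem A B) :
      Runs (rotateColumns : Prog A B) (v, m) 1 (v, m) := .done (by simp [hv])
  have idEx (v : Reg) (hv : v.tag = 0) (m : Mem A B) :
      Runs (exchange : Prog A B) (v, m) 1 (v, m) := .done (by simp [hv])
  have noEnd (v : Reg) (hv : v.f = false) (m : Mem A B) :
      Runs (.block [pushRowEnd, .load fun v => { v with f := false }]) (v, m) 0 (v, m) := .block (by
    obtain ⟨r, q, p, f, g, tag⟩ := v
    simp_all)
  obtain ⟨X, Y, g⟩ := s
  dsimp only at *
  by_cases h : X.headD [] = []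
  · have hs (b : Bool) : Sheet.step ⟨X, Y, g⟩ b = ⟨Y, [], !g⟩ := if_pos h
    have hr : isBit (encodeRows X).head? = false := by
      cases X with
      | nil => rfl
      | cons r X =>
        simp only [List.headD_cons] at h
        subst h
        rfl
    have k₁ := runs_clear (A := A) (B := B) .x { g := g, tag := 1 } i o
      { x := (encodeRows X).tail, y := (encodeRows Y).reverse, c₀ := c₀, c₁ := c₁ }
    have k₂ := runs_move (A := A) (B := B) .y .x (by decide) { g := g, tag := 1 } i o
      { y := (encodeRows Y).reverse, c₀ := c₀, c₁ := c₁ }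
    have k₃ := runs_move (A := A) (B := B) .t .x (by decide) { g := !g } i o
      { x := encodeRows Y, c₀ := c₀, c₁ := c₁ }
    have k₄ : Runs exchange _ _ _ :=
      Runs.step rfl (k₁.seq (k₂.seq (.block (s' := ({ g := !g }, ⟨i, o,
        { x := encodeRows Y, c₀ := c₀, c₁ := c₁ }⟩)) (by simp)))) (.done rfl)
    refine (Runs.seq (.block ?_) ((idCol _ rfl _).seq ((noEnd _ rfl _).seq ((idRot _ rfl _).seq
      (k₄.seq (k₃.seq (.block ?_))))))).mono ?_
    · simp [chooseMode, hr]
    · simp [hs]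
    · simp
      lia
  · obtain ⟨n, rfl⟩ : ∃ k, n = k + 1 := by
      cases X with
      | nil => simp at h
      | cons r X =>
        have := hX r (by simp)
        cases r with
        | nil => simp at h
        | cons b r => exact ⟨_, this.symm⟩
    have hlen := length_encodeRows hX
    have hr : isBit (encodeRows X).head? = true := by
      cases X with
      | nil => simp at h
      | cons r X =>
        cases r with
        | nil => simp at h
        | cons b r => simp [encodeRows_cons]
    have e := exists_columns hX
    set P := X.map fun r => (r.headD false, r.tail) with hP
    have hPl : P.length = X.length := by simp [hP]
    have hPn : ∀ p ∈ P, p.2.length ≤ n := by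
      simp only [hP, List.mem_map]
      rintro p ⟨r, hr, rfl⟩
      simp [hX r hr]
    have l₁ : (encodeRows (P.map Prod.snd)).length = X.length * (n + 1) := by
      rw [length_encodeRows (n := n) (by simp +contextual [hP, hX]), List.length_map, hPl]
    have l₂ : (encodeRows (P.map fun p => p.2 ++ [p.1])).length = X.length * (n + 2) := by
      rw [length_encodeRows (n := n + 1) (by simp +contextual [hP, hX]), List.length_map, hPl]
    have l₃ : X.length * (n + 1) ≤ X.length * (n + 2) := by gcongr; simp
    cases b with
    | true =>
      have k₁ := runs_column { f := true, g := g } i o (encodeRows Y).reverse [] [] c₀ c₁ P n hPn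
      have k₂ := runs_move (A := A) (B := B) .t .x (by decide) { g := g } i o
        { y := Γ'.comma :: (P.map fun p => Γ'.bit p.1).reverse ++ (encodeRows Y).reverse
          t := (encodeRows (P.map Prod.snd)).reverse, c₀ := c₀, c₁ := c₁ }
      rw [← e] at k₁
      refine (Runs.seq (.block ?_) (k₁.seq (.seq (.block rfl) ((idRot _ rfl _).seq
        ((idEx _ rfl _).seq ((k₂.cast' ?_).seq (.block ?_))))))).mono ?_
      · simp [chooseMode, hr]
      · simp
      · rw [Sheet.step, if_neg h]
        simp [hP, encodeRows_append, encodeRows_cons, Function.comp_def]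
      · simp [l₁, hPl]
        lia
    | false =>
      have k₁ := runs_rotateColumns { g := g } rfl i o (encodeRows Y).reverse c₀ c₁ P n hPn
      have k₂ := runs_move (A := A) (B := B) .t .x (by decide) { g := g } i o
        { y := (encodeRows Y).reverse
          t := (encodeRows (P.map fun p => p.2 ++ [p.1])).reverse, c₀ := c₀, c₁ := c₁ }
      rw [← e] at k₁
      refine (Runs.seq (.block ?_) ((idCol _ rfl _).seq ((noEnd _ rfl _).seq (k₁.seq
        ((idEx _ rfl _).seq ((k₂.cast' ?_).seq (.block ?_))))))).mono ?_
      · simp [chooseMode, hr]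
      · simp
      · have hrot : (X.map fun r => r.rotate 1) = X.map fun r => r.tail ++ [r.headD false] :=
          List.map_congr_left fun r hr => by
            cases r with
            | nil => simpa using hX _ hr
            | cons b r => simp
        rw [Sheet.step, if_neg h]
        simp [hP, hrot, Function.comp_def]
      · simp [l₂, hPl]
        lia

/-- All rows have the right lengths, and the matrices have at most `N` rows and columns. -/
def Sheet.Bounded (s : Sheet) (N : ℕ) : Prop :=
  ∃ n, (∀ r ∈ s.rest, r.length = n) ∧ (∀ r ∈ s.done, r.length = s.rest.length) ∧
    s.rest.length ≤ N ∧ n + s.done.length ≤ N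

/-- Moving a column lowers `n` by one and adds one row to `done`, and an exchange swaps the two
dimensions. The sheet thus never outgrows its initial bound, and each bit of the certificate costs
the same bounded time. -/
theorem Sheet.Bounded.step {s : Sheet} {N : ℕ} (h : s.Bounded N) (b : Bool) :
    (s.step b).Bounded N := by
  obtain ⟨n, h₁, h₂, h₃, h₄⟩ := h
  rw [Sheet.step]
  split_ifs with h hb
  · exact ⟨s.rest.length, h₂, by simp, by dsimp only; lia, by simpa⟩
  · have hn : 0 < n := by
      cases hs : s.rest with
      | nil => simp [hs] at h
      | cons r R =>
        rw [← h₁ r (by simp [hs])]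
        exact List.length_pos_iff.2 (by simpa [hs] using h)
    refine ⟨n - 1, by simp +contextual [h₁], ?_, by simpa, by simp; lia⟩
    simp +contextual [or_imp, h₂]
  · exact ⟨n, by simp +contextual [h₁], by simpa using h₂, by simpa, h₄⟩

theorem Sheet.Bounded.foldl {s : Sheet} {N : ℕ} (h : s.Bounded N) (w : List Bool) :
    (w.foldl Sheet.step s).Bounded N := by
  induction w generalizing s with
  | nil => exact h
  | cons b w ih => exact ih (h.step b)

theorem Sheet.Bounded.length_rest {s : Sheet} {N : ℕ} (h : s.Bounded N) :
    (encodeRows s.rest).length ≤ N * (N + 1) := by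
  obtain ⟨n, h₁, h₂, h₃, h₄⟩ := h
  rw [length_encodeRows h₁]
  gcongr
  lia

theorem Sheet.Bounded.length_done {s : Sheet} {N : ℕ} (h : s.Bounded N) :
    (encodeRows s.done).length ≤ N * (N + 1) := by
  obtain ⟨n, h₁, h₂, h₃, h₄⟩ := h
  rw [length_encodeRows h₂]
  gcongr
  lia

/-- Rearrange a matrix, guided by the string on the stack `c₁`. -/
def rearrange : Prog A B :=
  .seq (.block [popQ .c₁]) (.loop (fun v => v.q.isSome) sheetStep)

theorem runs_rearrange (i : List A) (o : List B) (s : Sheet) (c₀ : List Γ') (w : List Bool)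
    (N : ℕ) (hs : s.Bounded N) :
    Runs rearrange ({ g := s.flipped }, ⟨i, o, { x := encodeRows s.rest
                                                 y := (encodeRows s.done).reverse
                                                 c₀ := c₀, c₁ := w.map Γ'.bit }⟩)
      (w.length * (4 * (N * (N + 1)) + 9) + 1)
      ({ g := (w.foldl Sheet.step s).flipped },
        ⟨i, o, { x := encodeRows (w.foldl Sheet.step s).rest
                 y := (encodeRows (w.foldl Sheet.step s).done).reverse, c₀ := c₀ }⟩) := by
  have h := Runs.scan (A := A) (B := B) (c := fun v => v.q.isSome) (p := sheetStep)
    (n := 4 * (N * (N + 1)) + 8)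
    (fun pre suf => ({ q := (suf.map Γ'.bit).head?, g := (pre.foldl Sheet.step s).flipped },
        ⟨i, o, { x := encodeRows (pre.foldl Sheet.step s).rest
                 y := (encodeRows (pre.foldl Sheet.step s).done).reverse
                 c₀ := c₀, c₁ := (suf.map Γ'.bit).tail }⟩)) w rfl
    (fun _ _ _ _ => rfl) fun pre b suf _ => by
      have hb := hs.foldl pre
      obtain ⟨n, h₁, -⟩ := id hb
      refine (runs_sheetStep i o _ b c₀ (suf.map Γ'.bit) n _ h₁ hb.length_rest
        hb.length_done).cast ?_
      simp
  exact Runs.seq' (.block rfl) h (by lia)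

/-- Compare the stacks `x` and `c₀`. -/
def compareStacks : Prog A B :=
  .seq (.block [popR .x, popQ .c₀])
    (.loop (fun v => v.r.isSome && decide (v.r = v.q)) (.block [popR .x, popQ .c₀]))

/-- The loop runs as long as the symbols agree; both registers end up empty iff both stacks run out
together. The leftovers are to be cleared, so only their lengths matter. -/
theorem runs_compareStacks (v : Reg) (i : List A) (o : List B) (x y c₀ : List Γ') :
    ∃ (r q : Option Γ') (x' z' : List Γ'), (r = none ∧ q = none ↔ x = c₀) ∧
      x'.length ≤ x.length ∧ z'.length ≤ c₀.length ∧
      Runs compareStacks (v, ⟨i, o, { x := x, y := y, c₀ := c₀ }⟩) (x.length + 1)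
        ({ v with r := r, q := q }, ⟨i, o, { x := x', y := y, c₀ := z' }⟩) := by
  suffices h : ∃ (r q : Option Γ') (x' z' : List Γ'), (r = none ∧ q = none ↔ x = c₀) ∧ x'.length ≤ x.length ∧
      z'.length ≤ c₀.length ∧
      Runs (A := A) (B := B) (.loop (fun v => v.r.isSome && decide (v.r = v.q))
        (.block [popR .x, popQ .c₀])) ({ v with r := x.head?, q := c₀.head? },
          ⟨i, o, { x := x.tail, y := y, c₀ := c₀.tail }⟩) (x.length + 1)
        ({ v with r := r, q := q }, ⟨i, o, { x := x', y := y, c₀ := z' }⟩) by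
    obtain ⟨r, q, x', z', h₁, h₂, h₃, h₄⟩ := h
    exact ⟨r, q, x', z', h₁, h₂, h₃, .seq' (.block rfl) h₄ (by lia)⟩
  induction x generalizing c₀ with
  | nil =>
    refine ⟨_, _, _, _, ?_, ?_, ?_, .done rfl⟩
    · cases c₀ <;> simp
    · simp
    · simp
  | cons s x ih =>
    by_cases hs : c₀.head? = some s
    · obtain ⟨c₀, rfl⟩ : ∃ l, c₀ = s :: l := by
        cases c₀ with
        | nil => simp at hs
        | cons s' l => exact ⟨l, by simpa using hs⟩
      obtain ⟨r, q, x', z', h₁, h₂, h₃, h₄⟩ := ih c₀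
      refine ⟨r, q, x', z', by simpa using h₁, by simp; lia, by simp; lia, ?_⟩
      exact (Runs.step (by simp) (.block rfl) h₄).mono (by simp)
    · refine ⟨_, _, _, _, ?_, ?_, ?_, (Runs.done ?_).mono (by simp)⟩
      · simp only [List.head?_cons, reduceCtorEq, false_and, false_iff]
        rintro rfl
        exact hs rfl
      · simp
      · simp
      · simpa [eq_comm] using hs

/-- Write the verdict and clean up. -/
def verdict : Prog A Bool :=
  .seq (.block [popP .y, .push .out fun v => some (v.r.isNone && v.q.isNone && v.p.isNone && !v.g)])
    (.seq (clear .x) (.seq (clear .y) (.seq (clear .c₀) (.block [.load fun _ => {}]))))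

/-- Rearrange the first matrix of the input, guided by the string of bits, and compare it with the
second one. -/
def verifyProg : Prog ((Γ' ⊕ Γ') ⊕ Bool) Bool :=
  .seq (split (Sum.elim (Sum.elim (fun s => (s, 0)) fun s => (s, 1)) fun b => (.bit b, 2)))
    (.seq (move .a .x) (.seq (move .b .c₀) (.seq (move .c .c₁)
      (.seq rearrange (.seq compareStacks verdict)))))

theorem runs_verifyProg (R R' : List (List Bool)) (w : List Bool) (N : ℕ)
    (hR : (Sheet.mk R [] false).Bounded N) :
    Runs verifyProg
      ({}, ⟨((encodeRows R).map Sum.inl ++ (encodeRows R').map Sum.inr).map Sum.inl ++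
        w.map Sum.inr, [], {}⟩)
      (2 * ((encodeRows R).length + (encodeRows R').length + w.length) +
        w.length * (4 * (N * (N + 1)) + 9) + 3 * (N * (N + 1)) + (encodeRows R').length + 10)
      ({}, ⟨[], [decide (w.foldl Sheet.step ⟨R, [], false⟩ = ⟨R', [], false⟩)], {}⟩) := by
  have h₁ := runs_split (B := Bool)
    (Sum.elim (Sum.elim (fun s => (s, 0)) fun s => (s, 1)) fun b => (.bit b, 2))
    (((encodeRows R).map Sum.inl ++ (encodeRows R').map Sum.inr).map Sum.inl ++ w.map Sum.inr) []
  simp only [List.filter_append, List.filter_map, Function.comp_def, Sum.elim_inl, Sum.elim_inr,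
    List.map_append, List.map_map] at h₁
  simp only [decide_true, List.filter_true, List.map_id', show (1 : Fin 3) ≠ 0 by decide,
    show (0 : Fin 3) ≠ 1 by decide, show (0 : Fin 3) ≠ 2 by decide, show (1 : Fin 3) ≠ 2 by decide,
    show (2 : Fin 3) ≠ 0 by decide, show (2 : Fin 3) ≠ 1 by decide,
    decide_false, List.filter_false, List.map_nil, List.append_nil, List.nil_append] at h₁
  have h₂ : Runs (A := (Γ' ⊕ Γ') ⊕ Bool) (B := Bool) (move .a .x)
      ({}, ⟨[], [], { a := (encodeRows R).reverse, b := (encodeRows R').reverse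
                      c := (w.map Γ'.bit).reverse }⟩) ((encodeRows R).length + 1)
      ({}, ⟨[], [], { x := encodeRows R, b := (encodeRows R').reverse
                      c := (w.map Γ'.bit).reverse }⟩) := by
    simpa using runs_move .a .x (by decide) {} [] [] { a := (encodeRows R).reverse
                                                       b := (encodeRows R').reverse
                                                       c := (w.map Γ'.bit).reverse }
  have h₃ : Runs (A := (Γ' ⊕ Γ') ⊕ Bool) (B := Bool) (move .b .c₀)
      ({}, ⟨[], [], { x := encodeRows R, b := (encodeRows R').reverse
                      c := (w.map Γ'.bit).reverse }⟩) ((encodeRows R').length + 1)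
      ({}, ⟨[], [], { x := encodeRows R, c₀ := encodeRows R', c := (w.map Γ'.bit).reverse }⟩) := by
    simpa using runs_move .b .c₀ (by decide) {} [] [] { x := encodeRows R
                                                        b := (encodeRows R').reverse
                                                        c := (w.map Γ'.bit).reverse }
  have h₄ : Runs (A := (Γ' ⊕ Γ') ⊕ Bool) (B := Bool) (move .c .c₁)
      ({}, ⟨[], [], { x := encodeRows R, c₀ := encodeRows R', c := (w.map Γ'.bit).reverse }⟩)
      (w.length + 1)
      ({}, ⟨[], [], { x := encodeRows R, c₀ := encodeRows R', c₁ := w.map Γ'.bit }⟩) := by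
    simpa using runs_move .c .c₁ (by decide) {} [] [] { x := encodeRows R, c₀ := encodeRows R'
                                                        c := (w.map Γ'.bit).reverse }
  have h₅ := runs_rearrange (A := (Γ' ⊕ Γ') ⊕ Bool) (B := Bool) [] [] _ (encodeRows R') w N hR
  have hb := hR.foldl w
  set s := w.foldl Sheet.step ⟨R, [], false⟩ with hs
  obtain ⟨r, q, x, z, e, hx, hz, h₆⟩ := runs_compareStacks (A := (Γ' ⊕ Γ') ⊕ Bool) (B := Bool)
    { g := s.flipped } [] [] (encodeRows s.rest) (encodeRows s.done).reverse (encodeRows R')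
  have hx' := hb.length_rest
  have hy' := hb.length_done
  set y := (encodeRows s.done).reverse with hy
  have hyl : y.length = (encodeRows s.done).length := by simp [hy]
  set d := decide (s = ⟨R', [], false⟩) with hd
  -- Injectivity of `encodeRows` turns equality of the strings into equality of the matrices. The
  -- other conditions say that `done` is empty and the orientation is the original one.
  have hv : (r.isNone && q.isNone && y.head?.isNone && !s.flipped) = d := by
    rw [Bool.eq_iff_iff, hd, decide_eq_true_iff]
    have hy₀ : y = [] ↔ s.done = [] := by
      rw [hy, List.reverse_eq_nil_iff, ← encodeRows_nil, encodeRows_injective.eq_iff]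
    rw [encodeRows_injective.eq_iff] at e
    rw [Sheet.ext_iff, ← e, ← hy₀]
    simp [and_assoc]
  have h₇ := runs_clear (A := (Γ' ⊕ Γ') ⊕ Bool) (B := Bool) .x
    { r := r, q := q, p := y.head?, g := s.flipped } [] [d] { x := x, y := y.tail, c₀ := z }
  have h₈ := runs_clear (A := (Γ' ⊕ Γ') ⊕ Bool) (B := Bool) .y
    { r := r, q := q, g := s.flipped } [] [d] { y := y.tail, c₀ := z }
  have h₉ := runs_clear (A := (Γ' ⊕ Γ') ⊕ Bool) (B := Bool) .c₀
    { r := r, q := q, g := s.flipped } [] [d] { c₀ := z }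
  have h : Runs verdict ({ r := r, q := q, g := s.flipped },
      ⟨([] : List ((Γ' ⊕ Γ') ⊕ Bool)), [], { x := x, y := y, c₀ := z }⟩) _
      ({}, ⟨[], [d], {}⟩) :=
    Runs.seq (.block (by simp [hv])) (h₇.seq (h₈.seq (h₉.seq (.block rfl))))
  simp only [List.map_append, List.map_map, Function.comp_def]
  refine (h₁.seq ((h₂.cast' ?_).seq (h₃.seq (h₄.seq (h₅.seq (h₆.seq h)))))).mono ?_
  · simp
  · simp
    lia

/-! ### Itemset Isomorphism is in NP -/

/-- The rows of a matrix with the given lists of row indices and column indices. -/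
def matrixRows {I K : Type} (M : I → K → Bool) (ρ : List I) (κ : List K) : List (List Bool) :=
  ρ.map fun i => κ.map (M i)

section Sheet

variable {I K : Type} {M : I → K → Bool}

theorem Sheet.step_nil (ρ : List I) (Y : List (List Bool)) (g b : Bool) :
    Sheet.step ⟨matrixRows M ρ [], Y, g⟩ b = ⟨Y, [], !g⟩ := by
  refine if_pos ?_
  cases ρ <;> rfl

theorem Sheet.step_cons {ρ : List I} (hρ : ρ ≠ []) (k : K) (κ κ' : List K) (g b : Bool) :
    Sheet.step ⟨matrixRows M ρ (k :: κ), matrixRows (flip M) κ' ρ, g⟩ b =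
      if b then ⟨matrixRows M ρ κ, matrixRows (flip M) (κ' ++ [k]) ρ, g⟩
      else ⟨matrixRows M ρ (κ ++ [k]), matrixRows (flip M) κ' ρ, g⟩ := by
  obtain ⟨i, ρ, rfl⟩ := List.exists_cons_of_ne_nil hρ
  rw [Sheet.step, if_neg (by simp [matrixRows])]
  simp [matrixRows, Function.comp_def]
  rfl

/-- The two parts of the sheet contain the columns of a matrix, up to the order of the columns and
of the rows. -/
def Sheet.Spans (s : Sheet) (M : I → K → Bool) (l : List I) (l' : List K) : Prop :=
  ∃ ρ κ κ', ρ ≠ [] ∧ ρ.Perm l ∧ (κ ++ κ').Perm l' ∧ s.rest = matrixRows M ρ κ ∧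
    s.done = matrixRows (flip M) κ' ρ

/-- The row list `ρ` is nonempty, so the first row shows whether columns are left. If not, the moved
columns `κ'` become the rows of the transpose; the third outcome occurs when there were no columns
at all, and the information about the rows is lost. -/
theorem Sheet.Spans.step {s : Sheet} {l : List I} {l' : List K} (h : s.Spans M l l') (b : Bool) :
    ((s.step b).flipped = s.flipped ∧ (s.step b).Spans M l l') ∨
      ((s.step b).flipped = !s.flipped ∧ (s.step b).Spans (flip M) l' l) ∨
      ((s.step b).rest = [] ∧ (s.step b).done = []) := by
  obtain ⟨X, Y, g⟩ := s
  obtain ⟨ρ, κ, κ', hne, hρ, hκ, rfl, rfl⟩ := h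
  cases κ with
  | nil =>
    rw [Sheet.step_nil]
    rcases eq_or_ne κ' [] with rfl | h
    · exact .inr (.inr ⟨rfl, rfl⟩)
    · exact .inr (.inl ⟨rfl, κ', ρ, [], h, hκ, by simpa, rfl, rfl⟩)
  | cons k κ =>
    rw [Sheet.step_cons hne]
    refine .inl ?_
    cases b with
    | true =>
      refine ⟨rfl, ρ, κ, κ' ++ [k], hne, hρ, .trans ?_ hκ, rfl, rfl⟩
      rw [← List.append_assoc]
      exact List.perm_append_singleton k _
    | false =>
      exact ⟨rfl, ρ, κ ++ [k], κ', hne, hρ,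
        ((List.perm_append_singleton k _).append_right _).trans hκ, rfl, rfl⟩

theorem Sheet.spans_foldl {l : List I} {l' : List K} (w : List Bool) {s : Sheet}
    (h : (s.flipped = false ∧ s.Spans M l l') ∨ (s.flipped = true ∧ s.Spans (flip M) l' l) ∨
      (s.rest = [] ∧ s.done = [])) :
    ((w.foldl Sheet.step s).flipped = false ∧ (w.foldl Sheet.step s).Spans M l l') ∨
      ((w.foldl Sheet.step s).flipped = true ∧ (w.foldl Sheet.step s).Spans (flip M) l' l) ∨
      ((w.foldl Sheet.step s).rest = [] ∧ (w.foldl Sheet.step s).done = []) := by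
  induction w generalizing s with
  | nil => exact h
  | cons b w ih =>
    refine ih ?_
    rcases h with ⟨hs, h⟩ | ⟨hs, h⟩ | ⟨h, h'⟩
    · have := h.step b
      rw [hs] at this
      exact this
    · have := h.step b
      rw [hs] at this
      rcases this with h | h | h
      · exact .inr (.inl h)
      -- Here `flip (flip M)` is `M` by definition.
      · exact .inl h
      · exact .inr (.inr h)
    · refine .inr (.inr ?_)
      rw [Sheet.step, if_pos (by simp [h])]
      exact ⟨h', rfl⟩

theorem Sheet.foldl_rotate {ρ : List I} (hρ : ρ ≠ []) (κ σ : List K) (κ' : List K) (g : Bool) :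
    (List.replicate κ.length false).foldl Sheet.step
      ⟨matrixRows M ρ (κ ++ σ), matrixRows (flip M) κ' ρ, g⟩ =
      ⟨matrixRows M ρ (σ ++ κ), matrixRows (flip M) κ' ρ, g⟩ := by
  induction κ generalizing σ with
  | nil => simp
  | cons k κ ih =>
    rw [List.length_cons, List.replicate_succ, List.foldl_cons, List.cons_append,
      Sheet.step_cons hρ, if_neg (by simp), List.append_assoc, ih]
    simp

/-- To select the columns in the order `τ`, rotate until the next one is in front and then move it.
Each selection takes at most as many bits as columns remain. -/
theorem Sheet.exists_foldl_columns {ρ : List I} (hρ : ρ ≠ []) {τ κ : List K} (h : κ.Perm τ)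
    (κ' : List K) (g : Bool) : ∃ w : List Bool, w.length ≤ τ.length * τ.length ∧
      w.foldl Sheet.step ⟨matrixRows M ρ κ, matrixRows (flip M) κ' ρ, g⟩ =
        ⟨matrixRows M ρ [], matrixRows (flip M) (κ' ++ τ) ρ, g⟩ := by
  induction τ generalizing κ κ' with
  | nil =>
    obtain rfl := h.eq_nil
    exact ⟨[], by simp, by simp⟩
  | cons k τ ih =>
    obtain ⟨σ, σ', rfl⟩ := List.append_of_mem (h.mem_iff.2 List.mem_cons_self)
    have h' : (σ ++ σ').Perm τ := (List.perm_middle.symm.trans h).cons_inv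
    obtain ⟨w, hw, e⟩ := ih (List.perm_append_comm.trans h') (κ' ++ [k])
    have hl := h'.length_eq
    rw [List.length_append] at hl
    refine ⟨List.replicate σ.length false ++ true :: w, ?_, ?_⟩
    · simp
      lia
    · rw [List.foldl_append, Sheet.foldl_rotate hρ, List.foldl_cons, List.cons_append,
        Sheet.step_cons hρ, if_pos rfl, e]
      simp

/-- The last bit triggers the exchange; its value is irrelevant, since no columns are left. -/
theorem Sheet.exists_foldl_transpose {ρ : List I} (hρ : ρ ≠ []) {τ κ : List K} (h : κ.Perm τ)
    (g : Bool) : ∃ w : List Bool, w.length ≤ τ.length * τ.length + 1 ∧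
      w.foldl Sheet.step ⟨matrixRows M ρ κ, [], g⟩ = ⟨matrixRows (flip M) τ ρ, [], !g⟩ := by
  obtain ⟨w, hw, e⟩ := Sheet.exists_foldl_columns (M := M) hρ h [] g
  refine ⟨w ++ [true], by simpa, ?_⟩
  have e' : matrixRows (flip M) [] ρ = [] := rfl
  rw [e'] at e
  rw [List.foldl_append, e, List.foldl_cons, Sheet.step_nil]
  rfl

/-- Exactly the matrices with permuted rows and columns can be reached. -/
theorem Sheet.exists_foldl_iff {l : List I} {l' : List K} (hl : l ≠ []) {R : List (List Bool)}
    (hR : R ≠ []) {n : ℕ} (hn : l'.length * l'.length + l.length * l.length + 2 ≤ n) :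
    (∃ w : List Bool, w.length ≤ n ∧
      w.foldl Sheet.step ⟨matrixRows M l l', [], false⟩ = ⟨R, [], false⟩) ↔
      ∃ ρ κ, ρ.Perm l ∧ κ.Perm l' ∧ R = matrixRows M ρ κ := by
  constructor
  · rintro ⟨w, -, h⟩
    have := Sheet.spans_foldl (M := M) (l := l) (l' := l') w
      (s := ⟨matrixRows M l l', [], false⟩)
      (.inl ⟨rfl, l, l', [], hl, .refl _, by simp, rfl, rfl⟩)
    rw [h] at this
    rcases this with ⟨-, ρ, κ, κ', -, hρ, hκ, rfl, h'⟩ | ⟨h', -⟩ | ⟨h', -⟩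
    · obtain rfl : κ' = [] := List.map_eq_nil_iff.1 h'.symm
      rw [List.append_nil] at hκ
      exact ⟨ρ, κ, hρ, hκ, rfl⟩
    · cases h'
    -- A sheet that has collapsed to nothing cannot equal the nonempty target.
    · exact absurd h' hR
  · rintro ⟨ρ, κ, hρ, hκ, rfl⟩
    rcases eq_or_ne κ [] with rfl | hne
    -- Without columns an exchange would forget the number of rows. But then all rows are empty, any
    -- order of them gives the same matrix, and the empty script suffices.
    · obtain rfl := hκ.nil_eq
      refine ⟨[], by simp, ?_⟩
      simp [matrixRows, hρ.length_eq]
    -- The first transposition puts the columns in order, the second one the rows, and the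
    -- orientation is restored.
    · obtain ⟨w, hw, e⟩ := Sheet.exists_foldl_transpose (M := M) hl hκ.symm false
      obtain ⟨w', hw', e'⟩ := Sheet.exists_foldl_transpose (M := flip M) hne hρ.symm true
      rw [hκ.length_eq] at hw
      rw [hρ.length_eq] at hw'
      refine ⟨w ++ w', by rw [List.length_append]; lia, ?_⟩
      rw [List.foldl_append, e]
      exact e'

end Sheet

/-! ### Itemset isomorphism as equality of matrices up to permutation -/

theorem Itemset.rows_eq_matrixRows (S : Itemset) :
    S.rows = matrixRows (fun I d => decide (d ∈ I)) (Finset.univ :: S.items)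
      (List.finRange S.dom) := by
  simp [Itemset.rows, matrixRows, List.ofFn_eq_map]

theorem matrixRows_mem_injective (n : ℕ) : Function.Injective fun ρ : List (Finset (Fin n)) =>
    matrixRows (fun I d => decide (d ∈ I)) ρ (List.finRange n) := by
  refine List.map_injective_iff.2 fun I I' h => ?_
  ext d
  have := List.map_inj_left.1 h d (List.mem_finRange d)
  simpa using this

/-- A bijection of the domains is an order of the columns, and the order of the rows is free because
items form a set. The header is the full set, which every bijection preserves, so it may be permuted
along with the items. -/
theorem Itemset.isomorphic_iff_exists_perm (S T : Itemset) :
    ItemsetIsomorphic S.toFinset T.toFinset ↔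
      ∃ ρ κ, ρ.Perm (Finset.univ :: S.items) ∧ κ.Perm (List.finRange S.dom) ∧
        T.rows = matrixRows (fun I d => decide (d ∈ I)) ρ κ := by
  have key (J : Fin S.dom ≃ Fin T.dom) (ρ : List (Finset (Fin S.dom))) :
      matrixRows (fun I d => decide (d ∈ I)) ρ ((List.finRange T.dom).map J.symm) =
        matrixRows (fun I d => decide (d ∈ I)) (ρ.map fun I => I.image J)
          (List.finRange T.dom) := by
    simp only [matrixRows, List.map_map]
    refine List.map_congr_left fun I _ => List.map_congr_left fun d _ => ?_
    simp [← J.eq_symm_apply]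
  have hu (J : Fin S.dom ≃ Fin T.dom) : (Finset.univ : Finset (Fin S.dom)).image J = Finset.univ :=
    Finset.image_univ_of_surjective J.surjective
  have hinj (J : Fin S.dom ≃ Fin T.dom) : Function.Injective fun I : Finset (Fin S.dom) => I.image J :=
    Finset.image_injective J.injective
  constructor
  · rintro ⟨J, hJ⟩
    have hp : (S.items.map fun I => I.image J).Perm T.items := by
      rw [List.perm_ext_iff_of_nodup (S.nodup.map (hinj J)) T.nodup]
      intro I
      have := Finset.ext_iff.1 hJ I
      simpa [Itemset.toFinset] using this
    have hs : (fun I : Finset (Fin S.dom) => I.image J).LeftInverse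
        fun I : Finset (Fin T.dom) => I.image J.symm := fun I => by simp [Finset.image_image]
    have hs' : (fun I : Finset (Fin T.dom) => I.image J.symm).LeftInverse
        fun I : Finset (Fin S.dom) => I.image J := fun I => by simp [Finset.image_image]
    refine ⟨(Finset.univ :: T.items).map fun I => I.image J.symm, (List.finRange T.dom).map J.symm,
      ?_, ?_, ?_⟩
    · have h : (Finset.univ :: T.items).Perm
          ((Finset.univ :: S.items).map fun I => I.image J) := by
        rw [List.map_cons, hu]
        exact hp.symm.cons _
      have := h.map fun I => I.image J.symm
      rwa [List.map_map, hs'.comp_eq_id, List.map_id] at this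
    · refine (List.perm_ext_iff_of_nodup ((List.nodup_finRange _).map J.symm.injective)
        (List.nodup_finRange _)).2 fun d => ?_
      simpa using ⟨J d, J.symm_apply_apply d⟩
    · rw [key, List.map_map, hs.comp_eq_id, List.map_id, T.rows_eq_matrixRows]
  · rintro ⟨ρ, κ, hρ, hκ, e⟩
    -- The header row guarantees a row to compare lengths with, even if there are no items.
    have hlen : κ.length = T.dom := by
      have : List.replicate T.dom true ∈ T.rows := List.mem_cons_self
      rw [e] at this
      obtain ⟨I, -, h⟩ := List.mem_map.1 this
      simpa using congrArg List.length h
    have hnd : κ.Nodup := hκ.nodup_iff.2 (List.nodup_finRange _)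
    -- `J` sends the element at position `k` of `κ` to `k`.
    let J : Fin S.dom ≃ Fin T.dom :=
      (hnd.getEquivOfForallMemList κ fun d => hκ.mem_iff.2 (List.mem_finRange d)).symm.trans
        (finCongr hlen)
    have hκ' : κ = (List.finRange T.dom).map J.symm :=
      List.ext_getElem (by simpa using hlen) fun k h h' => by simp [J]
    rw [hκ', key, T.rows_eq_matrixRows] at e
    have h := hρ.map fun I => I.image J
    -- Both lists of rows now start with the full set, which is cancelled by `cons_inv` below; an
    -- item equal to the full set does no harm, since multiplicities are respected.
    rw [← matrixRows_mem_injective _ e, List.map_cons, hu J] at h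
    refine ⟨J, ?_⟩
    ext I
    simp [Itemset.toFinset, h.cons_inv.mem_iff]

theorem ii_inNP : InNP II := by
  refine ⟨2 * .X ^ 2 + 2, fun z => decide (z.2.foldl Sheet.step ⟨z.1.1.rows, [], false⟩ =
    ⟨z.1.2.rows, [], false⟩), ?_, ?_⟩
  · have : Inhabited ((Γ' ⊕ Γ') ⊕ Bool) := ⟨.inr default⟩
    refine computableInPolyTime_of_runs
      (ea := fun z : (Itemset × Itemset) × List Bool => ((encodeRows z.1.1.rows).map Sum.inl ++
        (encodeRows z.1.2.rows).map Sum.inr).map Sum.inl ++ z.2.map Sum.inr)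
      (eb := fun b => [b]) verifyProg
      (2 * .X + .X * (4 * (.X * (.X + 1)) + 9) + 3 * (.X * (.X + 1)) + .X + 10) ?_
    rintro ⟨⟨S, T⟩, w⟩
    -- The length of the encoded matrix bounds both its number of rows and its number of columns.
    have hb : (Sheet.mk S.rows [] false).Bounded (encodeRows S.rows).length := by
      refine ⟨S.dom, S.length_of_mem_rows, by simp, ?_, by simpa using S.dom_le⟩
      rw [length_encodeRows S.length_of_mem_rows]
      exact Nat.le_mul_of_pos_right _ (Nat.succ_pos _)
    refine (runs_verifyProg S.rows T.rows w _ hb).mono ?_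
    simp only [List.length_append, List.length_map]
    simp only [Polynomial.eval_add, Polynomial.eval_mul, Polynomial.eval_X, Polynomial.eval_ofNat,
      Polynomial.eval_one]
    gcongr <;> lia
  · rintro ⟨S, T⟩
    have hl : (II.enc.encode (S, T)).length =
        (encodeRows S.rows).length + (encodeRows T.rows).length := by
      simp [encodingProd, II, Itemset.encoding, encodingOfInjective]
    have hm : (Finset.univ :: S.items).length ≤ (encodeRows S.rows).length := by
      rw [S.length_encodeRows_rows]
      exact Nat.le_mul_of_pos_right _ (Nat.succ_pos _)
    have hn : (List.finRange S.dom).length ≤ (encodeRows S.rows).length := by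
      simpa using S.dom_le
    rw [hl]
    simp only [decide_eq_true_eq, Polynomial.eval_add, Polynomial.eval_mul, Polynomial.eval_X,
      Polynomial.eval_ofNat, Polynomial.eval_pow]
    have h := Sheet.exists_foldl_iff (M := fun (I : Finset (Fin S.dom)) d => decide (d ∈ I))
      (l := Finset.univ :: S.items) (l' := List.finRange S.dom) (R := T.rows) (by simp)
      (by simp [Itemset.rows])
      -- Each of the two transpositions needs at most the square of a dimension plus one bit, and
      -- both dimensions are at most the input length.
      (n := 2 * ((encodeRows S.rows).length + (encodeRows T.rows).length) ^ 2 + 2) (by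
        rw [pow_two, two_mul]
        gcongr <;> lia)
    rw [← S.rows_eq_matrixRows] at h
    exact (S.isomorphic_iff_exists_perm T).trans h.symm

end IsoComplexity

theorem mainTheorem1 :
    IsoComplexity.PolyTimeReducible IsoComplexity.GI IsoComplexity.II ∧
      IsoComplexity.PolyTimeReducible IsoComplexity.II IsoComplexity.GI ∧
      IsoComplexity.InNP IsoComplexity.II :=
  ⟨IsoComplexity.gi_reducible_ii, IsoComplexity.ii_reducible_gi, IsoComplexity.ii_inNP⟩
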